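/- Let $n\ge 0$ and $u\ge 1$ be integers, let $\Gamma=(\mathbb Z/u\mathbb Z)^{*n}$ be the free power with standard generators $\gamma_1,\dots,\gamma_n$, and let $\mathcal U$ be an ultrafilter on $\mathbb N$. **Local statistics.** For an action $\mathsf a$ of $\Gamma$ on a probability space $(X,\mu)$ by measure-preserving measurable maps, let $\mathcal H(\mathsf a)$ be the $u$-uniform hypergraph on $X$ whose edges are the sets $\{x,\gamma_jx,\dots,\gamma_j^{u-1}x\}$ with $\gamma_j^m x\ne x$ for $0<m<u$. Label each ordered edge $(x_1,\dots,x_u)$ by the set $d_{\mathsf a}(x_1,\dots,x_u)$ of all $(\gamma_j,i_2,\dots,i_u)$, $0\le i_m<u$, with $\gamma_j^{i_m}x_1=x_m$ for $m=2,\dots,u$. For $r,k\in\mathbb N$ let $\mathbb L$ be the finite set of isomorphism classes of rooted $u$-uniform hypergraphs of degree at most $n$, all of whose vertices are at distance at most $r$ from the root, with vertices labelled by $[k]$ and ordered edges labelled by sets of such tuples $(\gamma_j,i_2,\dots,i_u)$. For a measurable $f:X\to[k]$ let $\mu^r(f,\mathsf a)$ be the probability measure on $\mathbb L$ which is the distribution,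 for $\mu$-random $x$, of the isomorphism class of the ball of radius $r$ around $x$ in $\mathcal H(\mathsf a)$ (the sub-hypergraph of the edges contained in it), rooted at $x$ and labelled by $f$ and $d_{\mathsf a}$. The set $\mathcal L_{r,k}(\mathsf a)$ of $(r,k)$-local statistics is the closure of $\{\mu^r(f,\mathsf a): f:X\to[k]\text{ measurable}\}$ for the total variation metric $\sum_{c\in\mathbb L}|p(c)-q(c)|$. **Ultraproducts.** If the fixed-point sets $\operatorname{fix}(\delta)$, $\delta\in\Gamma$, are $\mu$-measurable (as they are on a standard Borel space), let $M(\mathsf a)=(L^\infty(X,\mu),\gamma_1,\dots,\gamma_n,(\mathbf 1_{\operatorname{fix}(\delta)})_{\delta\in\Gamma})$, where $L^\infty(X,\mu)$ is the complex tracial $*$-algebra with trace $\int f\,d\mu$ and $(\gamma f)(x)=f(\gamma^{-1}x)$. For actions $\mathsf a_i$ on $(X_i,\mu_i)$, $i\in\mathbb N$, let $\lim_{\mathcal U}M(\mathsf a_i)$ be the algebra of uniformly bounded sequences $(f_i)$, $f_i\in L^\infty(X_i,\mu_i)$, modulo the ideal of those with $\lim_{\mathcal U}\|f_i\|_{L^2}=0$,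 with trace, involution, automorphisms $\gamma_j$ and constants $\mathbf 1_{\operatorname{fix}(\delta)}$ defined as pointwise ultralimits. An action $\mathsf a$ of $\Gamma$ on an arbitrary (not necessarily standard) probability space is an ultraproduct of the $\mathsf a_i$ along $\mathcal U$ if $M(\mathsf a)\cong\lim_{\mathcal U}M(\mathsf a_i)$ by an isomorphism of $*$-algebras preserving the trace, the automorphisms $\gamma_j$ and the constants $\mathbf 1_{\operatorname{fix}(\delta)}$. **Theorem.** Let $\mathsf a_i$ ($i\in\mathbb N$) be probability-measure-preserving actions of $\Gamma$ on standard Borel probability spaces, and let $\mathsf a$ be an ultraproduct of $(\mathsf a_i)_{i\in\mathbb N}$ along $\mathcal U$. Then for all $r,k\in\mathbb N$, $$\mathcal L_{r,k}(\mathsf a)=\lim_{\mathcal U}\mathcal L_{r,k}(\mathsf a_i),$$ where the ultralimit is taken in the Hausdorff metric on closed sets. -/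

import Mathlib

open MeasureTheory Filter Topology

universe v w

/-! ## Rooted labelled hypergraphs and their isomorphism types -/

namespace LocalGlobal

/-- The set of vertices at distance at most `r` from `x` in the hypergraph `H`. -/
def ballSet {V : Type*} (H : Hypergraph V) (x : V) : ℕ → Set V
  | 0 => {x}
  | r + 1 => ballSet H x r ∪ {y | ∃ z ∈ ballSet H x r, H.Adj z y}

/-- The ordered edges `(x₁, …, x_u)` of a hypergraph: injective enumerations of its edges. -/
def orderedEdges {V : Type*} (u : ℕ) (H : Hypergraph V) : Set (Fin u → V) :=
  {x | Function.Injective x ∧ Set.range x ∈ H.edgeSet}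

/-- A hypergraph with a root, a labelling of vertices by `A` and a labelling of ordered edges
(`u`-tuples) by `B`. Only the labels of actual vertices and of actual ordered edges matter: the
others are ignored by the notion of isomorphism below. -/
structure RootedLabelled (u : ℕ) (A B : Type) (V : Type*) where
  graph : Hypergraph V
  root : V
  root_mem : root ∈ graph.vertexSet
  vertexLabel : V → A
  edgeLabel : (Fin u → V) → B

variable {u : ℕ} {A B : Type} {V W Z : Type*}

/-- `φ` is an isomorphism of rooted labelled hypergraphs. -/
structure IsIso (G : RootedLabelled u A B V) (H : RootedLabelled u A B W) (φ : V → W) : Prop where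
  bijOn : Set.BijOn φ G.graph.vertexSet H.graph.vertexSet
  edges : H.graph.edgeSet = (fun e => φ '' e) '' G.graph.edgeSet
  root : φ G.root = H.root
  vertexLabel : ∀ x ∈ G.graph.vertexSet, H.vertexLabel (φ x) = G.vertexLabel x
  edgeLabel : ∀ x ∈ orderedEdges u G.graph, H.edgeLabel (φ ∘ x) = G.edgeLabel x

/-- Two rooted labelled hypergraphs are isomorphic. -/
def Isomorphic (G : RootedLabelled u A B V) (H : RootedLabelled u A B W) : Prop :=
  ∃ φ : V → W, IsIso G H φ

theorem Isomorphic.refl (G : RootedLabelled u A B V) : Isomorphic G G :=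
  ⟨id, ⟨Set.bijOn_id _, by simp, rfl, fun _ _ => rfl, fun _ _ => rfl⟩⟩

theorem IsIso.mapsTo_orderedEdges {G : RootedLabelled u A B V} {H : RootedLabelled u A B W}
    {φ : V → W} (h : IsIso G H φ) {x : Fin u → V} (hx : x ∈ orderedEdges u G.graph) :
    φ ∘ x ∈ orderedEdges u H.graph := by
  refine ⟨?_, ?_⟩
  · intro i j hij
    refine hx.1 (h.bijOn.injOn ?_ ?_ hij)
    · exact G.graph.subset_vertexSet_of_mem_edgeSet hx.2 (Set.mem_range_self i)
    · exact G.graph.subset_vertexSet_of_mem_edgeSet hx.2 (Set.mem_range_self j)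
  · rw [h.edges, Set.range_comp]
    exact ⟨_, hx.2, rfl⟩

theorem Isomorphic.trans {G : RootedLabelled u A B V} {H : RootedLabelled u A B W}
    {K : RootedLabelled u A B Z} (h₁ : Isomorphic G H) (h₂ : Isomorphic H K) :
    Isomorphic G K := by
  obtain ⟨φ, hφ⟩ := h₁
  obtain ⟨ψ, hψ⟩ := h₂
  refine ⟨ψ ∘ φ, ⟨hψ.bijOn.comp hφ.bijOn, ?_, ?_, ?_, ?_⟩⟩
  · rw [hψ.edges, hφ.edges, Set.image_image]
    simp [Set.image_image]
  · simp [hφ.root, hψ.root]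
  · intro x hx
    simp [hψ.vertexLabel _ (hφ.bijOn.mapsTo hx), hφ.vertexLabel x hx]
  · intro x hx
    rw [Function.comp_assoc, hψ.edgeLabel _ (hφ.mapsTo_orderedEdges hx), hφ.edgeLabel x hx]

theorem Isomorphic.symm {G : RootedLabelled u A B V} {H : RootedLabelled u A B W}
    (h : Isomorphic G H) : Isomorphic H G := by
  obtain ⟨φ, hφ⟩ := h
  have : Nonempty V := ⟨G.root⟩
  have hinv := hφ.bijOn.invOn_invFunOn
  set ψ := Function.invFunOn φ G.graph.vertexSet
  have hb : Set.BijOn ψ H.graph.vertexSet G.graph.vertexSet := Set.BijOn.symm hinv.symm hφ.bijOn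
  have hE : G.graph.edgeSet = (fun e => ψ '' e) '' H.graph.edgeSet := by
    rw [hφ.edges, Set.image_image]
    ext e
    constructor
    · intro he
      exact ⟨e, he, hφ.bijOn.injOn.invFunOn_image
        (G.graph.subset_vertexSet_of_mem_edgeSet he)⟩
    · rintro ⟨e', he', rfl⟩
      have := hφ.bijOn.injOn.invFunOn_image (G.graph.subset_vertexSet_of_mem_edgeSet he')
      change ψ '' (φ '' e') ∈ _
      rw [this]
      exact he'
  refine ⟨ψ, ⟨hb, hE, ?_, ?_, ?_⟩⟩
  · rw [← hφ.root]
    exact hinv.1 G.root_mem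
  · intro y hy
    rw [← hφ.vertexLabel _ (hb.mapsTo hy), hinv.2 hy]
  · intro x hx
    have hsub : ∀ i, x i ∈ H.graph.vertexSet := fun i =>
      H.graph.subset_vertexSet_of_mem_edgeSet hx.2 (Set.mem_range_self i)
    have hψ : ψ ∘ x ∈ orderedEdges u G.graph := by
      refine ⟨fun i j hij => hx.1 (hb.injOn (hsub i) (hsub j) hij), ?_⟩
      rw [hE, Set.range_comp]
      exact ⟨_, hx.2, rfl⟩
    rw [← hφ.edgeLabel _ hψ]
    congr 1
    funext i
    exact hinv.2 (hsub i)

/-- A finite representative of a local type: a rooted labelled `u`-uniform hypergraph of degree at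
most `d` on `{0, …, m - 1}`, all of whose vertices are at distance at most `r` from the root. -/
structure LocalRep (r d u : ℕ) (A B : Type) where
  size : ℕ
  obj : RootedLabelled u A B (Fin size)
  vertexSet_eq : obj.graph.vertexSet = Set.univ
  uniform : ∀ e ∈ obj.graph.edgeSet, e.encard = u
  degree_le : ∀ x, {e ∈ obj.graph.edgeSet | x ∈ e}.encard ≤ d
  radius_le : ballSet obj.graph obj.root r = Set.univ

instance localRepSetoid (r d u : ℕ) (A B : Type) : Setoid (LocalRep r d u A B) where
  r G H := Isomorphic G.obj H.obj
  iseqv := ⟨fun G => .refl G.obj, fun h => h.symm, fun h₁ h₂ => h₁.trans h₂⟩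

/-- The set `𝕃(r, A, B, d, u)` of isomorphism classes of finite rooted `u`-uniform hypergraphs of
degree at most `d` and radius at most `r`, with vertices labelled by `A` and ordered edges labelled
by `B`. -/
def LocalType (r d u : ℕ) (A B : Type) : Type := Quotient (localRepSetoid r d u A B)

/-- The rooted labelled hypergraph `G` has isomorphism type `c`. -/
def HasType {r d : ℕ} (G : RootedLabelled u A B V) (c : LocalType r d u A B) : Prop :=
  ∃ H : LocalRep r d u A B, (Quotient.mk _ H : LocalType r d u A B) = c ∧ Isomorphic H.obj G

theorem ncard_ballSet_le [Finite V] (H : Hypergraph V) (x : V) (d : ℕ)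
    (hu : ∀ e ∈ H.edgeSet, e.encard = u) (hd : ∀ x, {e ∈ H.edgeSet | x ∈ e}.encard ≤ d) (r : ℕ) :
    (ballSet H x r).ncard ≤ (1 + d * u) ^ r := by
  classical
  have key : ∀ z, {y | H.Adj z y}.ncard ≤ d * u := by
    intro z
    have hfin : {e ∈ H.edgeSet | z ∈ e}.Finite := Set.toFinite _
    have h1 : {y | H.Adj z y} ⊆ ⋃ e ∈ hfin.toFinset, e := by
      rintro y ⟨e, he, hz, hy⟩
      simp only [Set.mem_iUnion]
      exact ⟨e, by simpa using ⟨he, hz⟩, hy⟩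
    refine (Set.ncard_le_ncard h1 (Set.toFinite _)).trans
      ((Finset.set_ncard_biUnion_le _ _).trans ?_)
    have h2 : ∀ e ∈ hfin.toFinset, e.ncard ≤ u := by
      intro e he
      have : e.encard = u := hu e (by simpa using ((hfin.mem_toFinset).1 he).1)
      simp [Set.ncard, this]
    refine (Finset.sum_le_card_nsmul _ _ _ h2).trans ?_
    rw [smul_eq_mul]
    refine Nat.mul_le_mul_right _ ?_
    have := hd z
    rw [hfin.encard_eq_coe_toFinset_card] at this
    exact_mod_cast this
  induction r with
  | zero => simp [ballSet]
  | succ r ih =>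
    have hs : ballSet H x (r + 1) =
        ballSet H x r ∪ ⋃ z ∈ (Set.toFinite (ballSet H x r)).toFinset, {y | H.Adj z y} := by
      ext y
      simp [ballSet]
    rw [hs]
    refine (Set.ncard_union_le _ _).trans ?_
    have h3 := (Finset.set_ncard_biUnion_le (Set.toFinite (ballSet H x r)).toFinset
      (fun z => {y | H.Adj z y})).trans (Finset.sum_le_card_nsmul _ _ _ (fun z _ => key z))
    rw [smul_eq_mul, ← Set.ncard_eq_toFinset_card] at h3
    calc _ ≤ (ballSet H x r).ncard + (ballSet H x r).ncard * (d * u) := by gcongr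
      _ = (ballSet H x r).ncard * (1 + d * u) := by ring
      _ ≤ (1 + d * u) ^ r * (1 + d * u) := by gcongr
      _ = _ := by ring

instance finite_rootedLabelled [Finite A] [Finite B] [Finite V] :
    Finite (RootedLabelled u A B V) := by
  refine Finite.of_injective (β := Set V × Set (Set V) × V × (V → A) × ((Fin u → V) → B))
    (fun G => (G.graph.vertexSet, G.graph.edgeSet, G.root, G.vertexLabel, G.edgeLabel)) ?_
  rintro ⟨g, o, ho, a, b⟩ ⟨g', o', ho', a', b'⟩ h
  simp only [Prod.mk.injEq] at h
  obtain ⟨h1, h2, rfl, rfl, rfl⟩ := h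
  obtain rfl : g = g' := Hypergraph.ext h1 h2
  rfl

instance finite_localType (r d u : ℕ) (A B : Type) [Finite A] [Finite B] :
    Finite (LocalType r d u A B) := by
  have : Finite (LocalRep r d u A B) := by
    refine Finite.of_injective
      (β := Σ m : Fin ((1 + d * u) ^ r + 1), RootedLabelled u A B (Fin m))
      (fun G => ⟨⟨G.size, ?_⟩, G.obj⟩) ?_
    · have := ncard_ballSet_le G.obj.graph G.obj.root d G.uniform G.degree_le r
      rw [G.radius_le, Set.ncard_univ, Nat.card_eq_fintype_card, Fintype.card_fin] at this
      omega
    · rintro ⟨m, G, _, _, _, _⟩ ⟨m', G', _, _, _, _⟩ h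
      simp only [Sigma.mk.injEq, Fin.mk.injEq] at h
      obtain ⟨rfl, h⟩ := h
      obtain rfl := eq_of_heq h
      rfl
  exact Quotient.finite _

noncomputable instance fintype_localType (r d u : ℕ) (A B : Type) [Finite A] [Finite B] :
    Fintype (LocalType r d u A B) := Fintype.ofFinite _

/-- The ball of radius `r` around `x` in a hypergraph with labelled vertices and ordered edges, as a
rooted labelled hypergraph: its vertices are those at distance at most `r` from `x`, its edges are
the edges spanned by them. -/
def ballAt (H : Hypergraph V) (f : V → A) (g : (Fin u → V) → B) (x : V) (r : ℕ) :
    RootedLabelled u A B V where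
  graph :=
    { vertexSet := ballSet H x r
      edgeSet := {e ∈ H.edgeSet | e ⊆ ballSet H x r}
      subset_vertexSet_of_mem_edgeSet' := fun _ he => he.2 }
  root := x
  root_mem := by
    induction r with
    | zero => exact rfl
    | succ r ih => exact Or.inl ih
  vertexLabel := f
  edgeLabel := g

/-! ## Actions of `(ℤ/u)^{*n}` and their local statistics -/

/-- The free power `(ℤ/uℤ)^{*n}`. -/
abbrev FreePower (n u : ℕ) : Type := Monoid.CoprodI fun _ : Fin n => Multiplicative (ZMod u)

/-- The standard generators of `(ℤ/uℤ)^{*n}`. -/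
def gen {n u : ℕ} (j : Fin n) : FreePower n u :=
  Monoid.CoprodI.of (M := fun _ : Fin n => Multiplicative (ZMod u)) (i := j)
    (Multiplicative.ofAdd 1)

/-- The Schreier hypergraph of an action of `(ℤ/uℤ)^{*n}`: the edges are the `u`-element orbits of
the generators. -/
def schreier (n u : ℕ) (X : Type*) [MulAction (FreePower n u) X] : Hypergraph X where
  vertexSet := Set.univ
  edgeSet := {e | ∃ (j : Fin n) (x : X),
    (∀ m : ℕ, 0 < m → m < u → (gen j : FreePower n u) ^ m • x ≠ x) ∧
    e = {y | ∃ m : ℕ, m < u ∧ y = (gen j : FreePower n u) ^ m • x}}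
  subset_vertexSet_of_mem_edgeSet' := fun _ _ => Set.subset_univ _

/-- The labels `(γ, i₂, …, i_u)` (a generator and exponents) which appear in the diagram. -/
abbrev DiagramLabel (n u : ℕ) [NeZero u] : Type := Fin n × ({m : Fin u // m ≠ 0} → Fin u)

/-- The diagram of an action: it labels the ordered edge `(x₁, …, x_u)` with the set of all
`(γ, i₂, …, i_u)` such that `γ ^ iₘ • x₁ = xₘ` for all `m`. -/
def diagram (n u : ℕ) [NeZero u] (X : Type*) [MulAction (FreePower n u) X] (x : Fin u → X) :
    Set (DiagramLabel n u) :=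
  {l | ∀ m : {m : Fin u // m ≠ 0}, (gen l.1 : FreePower n u) ^ (l.2 m : ℕ) • x 0 = x m}

/-- The finite set of types of balls of radius `r` in `k`-labelled actions of `(ℤ/uℤ)^{*n}`. -/
abbrev ActionType (n u r k : ℕ) [NeZero u] : Type :=
  LocalType r n u (Fin k) (Set (DiagramLabel n u))

/-- The space `ℝ^𝕃` over the finite set `𝕃` of types, with the distance `∑ c, |p c - q c|`.
Probability measures on `𝕃` are the vectors of their point masses; they form a closed subset, on
which the distance is the total variation distance. -/
abbrev StatSpace (n u r k : ℕ) [NeZero u] : Type := PiLp 1 fun _ : ActionType n u r k => ℝ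

section Statistics

variable (n u r k : ℕ) [NeZero u] {X : Type*} [MulAction (FreePower n u) X] [MeasurableSpace X]

/-- The `r`-local statistics of the vertex labelling `f` of an action: the mass of the type `c` is
the measure of the set of points `x` such that the ball of radius `r` around `x`, labelled by `f`
and by the diagram of the action, has type `c`. -/
noncomputable def localStatistics (μ : Measure X) (f : X → Fin k) : StatSpace n u r k :=
  WithLp.toLp 1 fun c : ActionType n u r k =>
    μ.real {x | HasType (ballAt (schreier n u X) f (diagram n u X) x r) c}

/-- The exact `(r, k)`-local statistics of an action. -/
def exactLocalStats (μ : Measure X) : Set (StatSpace n u r k) :=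
  {p | ∃ f : X → Fin k, Measurable f ∧ p = localStatistics n u r k μ f}

/-- The closed set of `(r, k)`-local statistics of an action. The type of closed sets carries
the Hausdorff (extended) metric. -/
def localStats (μ : Measure X) : TopologicalSpace.Closeds (StatSpace n u r k) :=
  .closure (exactLocalStats n u r k μ)

end Statistics

/-! ## The continuous model of an action, and ultraproducts -/

section FunctionAlgebra

variable {X : Type*} [MeasurableSpace X] {μ : Measure X}

noncomputable instance commRingAEEqFun : CommRing (X →ₘ[μ] ℂ) where
  __ := AEEqFun.instAddCommGroup
  __ := AEEqFun.instCommMonoid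
  left_distrib f g h := by
    induction f, g, h using AEEqFun.induction_on₃ with
    | _ f hf g hg h hh => simp [AEEqFun.mk_add_mk, AEEqFun.mk_mul_mk, mul_add]
  right_distrib f g h := by
    induction f, g, h using AEEqFun.induction_on₃ with
    | _ f hf g hg h hh => simp [AEEqFun.mk_add_mk, AEEqFun.mk_mul_mk, add_mul]
  zero_mul f := by
    induction f using AEEqFun.induction_on with
    | _ f hf =>
      rw [AEEqFun.zero_def, AEEqFun.mk_mul_mk, AEEqFun.mk_eq_mk]
      exact .of_forall fun x => zero_mul (f x)
  mul_zero f := by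
    induction f using AEEqFun.induction_on with
    | _ f hf =>
      rw [AEEqFun.zero_def, AEEqFun.mk_mul_mk, AEEqFun.mk_eq_mk]
      exact .of_forall fun x => mul_zero (f x)

noncomputable instance algebraAEEqFun : Algebra ℂ (X →ₘ[μ] ℂ) :=
  Algebra.ofModule
    (fun c f g => by
      induction f, g using AEEqFun.induction_on₂ with
      | _ f hf g hg =>
        rw [AEEqFun.smul_mk, AEEqFun.mk_mul_mk, AEEqFun.mk_mul_mk, AEEqFun.smul_mk,
          AEEqFun.mk_eq_mk]
        exact .of_forall fun x => smul_mul_assoc c (f x) (g x))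
    (fun c f g => by
      induction f, g using AEEqFun.induction_on₂ with
      | _ f hf g hg =>
        rw [AEEqFun.smul_mk, AEEqFun.mk_mul_mk, AEEqFun.mk_mul_mk, AEEqFun.smul_mk,
          AEEqFun.mk_eq_mk]
        exact .of_forall fun x => mul_smul_comm c (f x) (g x))

noncomputable instance starRingAEEqFun : StarRing (X →ₘ[μ] ℂ) where
  star_mul f g := by
    refine AEEqFun.ext ?_
    filter_upwards [AEEqFun.coeFn_star (f * g), AEEqFun.coeFn_mul f g,
      AEEqFun.coeFn_mul (star g) (star f), AEEqFun.coeFn_star f, AEEqFun.coeFn_star g]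
      with x h1 h2 h3 h4 h5
    rw [h1, Pi.star_apply, h2, h3, Pi.mul_apply, Pi.mul_apply, h4, h5, Pi.star_apply,
      Pi.star_apply, star_mul]
  star_add f g := by
    refine AEEqFun.ext ?_
    filter_upwards [AEEqFun.coeFn_star (f + g), AEEqFun.coeFn_add f g,
      AEEqFun.coeFn_add (star f) (star g), AEEqFun.coeFn_star f, AEEqFun.coeFn_star g]
      with x h1 h2 h3 h4 h5
    simp [h1, h2, h3, h4, h5]

noncomputable instance starModuleAEEqFun : StarModule ℂ (X →ₘ[μ] ℂ) where
  star_smul c f := by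
    refine AEEqFun.ext ?_
    filter_upwards [AEEqFun.coeFn_star (c • f), AEEqFun.coeFn_smul c f,
      AEEqFun.coeFn_smul (star c) (star f), AEEqFun.coeFn_star f] with x h1 h2 h3 h4
    rw [h1, Pi.star_apply, h2, h3, Pi.smul_apply, Pi.smul_apply, h4, Pi.star_apply, star_smul]

theorem ae_norm_algebraMap (c : ℂ) :
    ∀ᵐ x ∂μ, ‖(algebraMap ℂ (X →ₘ[μ] ℂ) c) x‖ ≤ ‖c‖ := by
  rw [Algebra.algebraMap_eq_smul_one]
  filter_upwards [AEEqFun.coeFn_smul c (1 : X →ₘ[μ] ℂ), AEEqFun.coeFn_one (μ := μ) (β := ℂ)]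
    with x h1 h2
  simp [h1, h2]

variable (μ) in
/-- The tracial von Neumann algebra `L^∞(X, μ)` of essentially bounded functions modulo almost
everywhere equality. -/
def Linf : StarSubalgebra ℂ (X →ₘ[μ] ℂ) where
  carrier := {f | ∃ C : ℝ, ∀ᵐ x ∂μ, ‖f x‖ ≤ C}
  mul_mem' := by
    rintro f g ⟨C, hC⟩ ⟨D, hD⟩
    refine ⟨C * D, ?_⟩
    filter_upwards [hC, hD, AEEqFun.coeFn_mul f g] with x h1 h2 h3
    rw [h3, Pi.mul_apply, norm_mul]
    exact mul_le_mul h1 h2 (norm_nonneg _) ((norm_nonneg _).trans h1)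
  add_mem' := by
    rintro f g ⟨C, hC⟩ ⟨D, hD⟩
    refine ⟨C + D, ?_⟩
    filter_upwards [hC, hD, AEEqFun.coeFn_add f g] with x h1 h2 h3
    rw [h3]
    exact (norm_add_le _ _).trans (add_le_add h1 h2)
  algebraMap_mem' c := ⟨‖c‖, ae_norm_algebraMap c⟩
  star_mem' := by
    rintro f ⟨C, hC⟩
    refine ⟨C, ?_⟩
    filter_upwards [hC, AEEqFun.coeFn_star f] with x h1 h2
    simpa [h2] using h1

variable (μ) in
/-- The trace `∫ f dμ = ⟨f, 1⟩`. -/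
noncomputable def trace (f : X →ₘ[μ] ℂ) : ℂ := ∫ x, f x ∂μ

variable {Γ : Type*} [Group Γ] [MulAction Γ X]

variable (μ) in
/-- The action of `γ` on functions: `(γ f)(x) = f (γ⁻¹ x)`. -/
noncomputable def translate [MeasurableConstSMul Γ X] [SMulInvariantMeasure Γ X μ] (γ : Γ)
    (f : X →ₘ[μ] ℂ) : X →ₘ[μ] ℂ :=
  f.compMeasurePreserving (fun x => γ⁻¹ • x) (measurePreserving_smul γ⁻¹ μ)

/-- The fixed-point sets of all the group elements are measurable with respect to the completion of
`μ`, so that their characteristic functions are elements of `L^∞(X, μ)`. This is automatic on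
standard Borel spaces. -/
class FixNullMeasurable (Γ : Type*) (X : Type*) [Group Γ] [MulAction Γ X] [MeasurableSpace X]
    (μ : Measure X) : Prop where
  nullMeasurableSet_fixedBy : ∀ δ : Γ, NullMeasurableSet (MulAction.fixedBy X δ) μ

instance fixNullMeasurable_of_standardBorel [StandardBorelSpace X] [MeasurableConstSMul Γ X] :
    FixNullMeasurable Γ X μ where
  nullMeasurableSet_fixedBy δ :=
    (measurableSet_eq_fun (measurable_const_smul δ) measurable_id).nullMeasurableSet

variable (μ) in
/-- The characteristic function of the set of fixed points of `δ`. -/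
noncomputable def fixIndicator [FixNullMeasurable Γ X μ] (δ : Γ) : X →ₘ[μ] ℂ :=
  AEEqFun.mk ((MulAction.fixedBy X δ).indicator fun _ => 1)
    (aestronglyMeasurable_const.indicator₀
      (FixNullMeasurable.nullMeasurableSet_fixedBy (μ := μ) δ))

theorem ae_norm_translate [MeasurableConstSMul Γ X] [SMulInvariantMeasure Γ X μ] (γ : Γ)
    {f : X →ₘ[μ] ℂ} {C : ℝ} (h : ∀ᵐ x ∂μ, ‖f x‖ ≤ C) : ∀ᵐ x ∂μ, ‖translate μ γ f x‖ ≤ C := by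
  have hm := measurePreserving_smul γ⁻¹ μ
  filter_upwards [f.coeFn_compMeasurePreserving hm, hm.quasiMeasurePreserving.ae h] with x h1 h2
  rw [translate, h1]
  exact h2

theorem ae_norm_fixIndicator [FixNullMeasurable Γ X μ] (δ : Γ) :
    ∀ᵐ x ∂μ, ‖fixIndicator μ δ x‖ ≤ 1 := by
  have h := AEEqFun.coeFn_mk ((MulAction.fixedBy X δ).indicator fun _ => (1 : ℂ))
    (aestronglyMeasurable_const.indicator₀
      (FixNullMeasurable.nullMeasurableSet_fixedBy (μ := μ) δ))
  filter_upwards [h] with x hx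
  rw [fixIndicator, hx]
  exact (norm_indicator_le_norm_self _ _).trans (by simp)

end FunctionAlgebra

section Ultraproduct

variable {X : ℕ → Type*} [∀ i, MeasurableSpace (X i)]

/-- Uniformly bounded sequences `⟨f_i⟩` with `f_i ∈ L^∞(X_i, μ_i)`. -/
def BddSeq (μ : ∀ i, Measure (X i)) : StarSubalgebra ℂ (∀ i, X i →ₘ[μ i] ℂ) where
  carrier := {f | ∃ N : ℝ, ∀ i, ∀ᵐ x ∂μ i, ‖f i x‖ ≤ N}
  mul_mem' := by
    rintro f g ⟨C, hC⟩ ⟨D, hD⟩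
    refine ⟨C * D, fun i => ?_⟩
    filter_upwards [hC i, hD i, AEEqFun.coeFn_mul (f i) (g i)] with x h1 h2 h3
    rw [Pi.mul_apply, h3, Pi.mul_apply, norm_mul]
    exact mul_le_mul h1 h2 (norm_nonneg _) ((norm_nonneg _).trans h1)
  add_mem' := by
    rintro f g ⟨C, hC⟩ ⟨D, hD⟩
    refine ⟨C + D, fun i => ?_⟩
    filter_upwards [hC i, hD i, AEEqFun.coeFn_add (f i) (g i)] with x h1 h2 h3
    rw [Pi.add_apply, h3]
    exact (norm_add_le _ _).trans (add_le_add h1 h2)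
  algebraMap_mem' c := ⟨‖c‖, fun _ => ae_norm_algebraMap c⟩
  star_mem' := by
    rintro f ⟨C, hC⟩
    refine ⟨C, fun i => ?_⟩
    filter_upwards [hC i, AEEqFun.coeFn_star (f i)] with x h1 h2
    simpa [h2] using h1

/-- The ideal of sequences whose `L²`-norms tend to `0` along `U`. -/
noncomputable def nullIdeal (U : Ultrafilter ℕ) (μ : ∀ i, Measure (X i)) : Ideal (BddSeq μ) where
  carrier := {f | Tendsto (fun i => eLpNorm (f.1 i) 2 (μ i)) U (𝓝 0)}
  zero_mem' := by
    refine tendsto_const_nhds.congr fun i => ?_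
    exact ((eLpNorm_congr_ae (AEEqFun.coeFn_zero (μ := μ i) (β := ℂ))).trans eLpNorm_zero).symm
  add_mem' := by
    intro f g hf hg
    have h := Tendsto.add hf hg
    rw [add_zero] at h
    refine tendsto_of_tendsto_of_tendsto_of_le_of_le tendsto_const_nhds h (fun _ => zero_le)
      fun i => ?_
    exact (eLpNorm_congr_ae (AEEqFun.coeFn_add (f.1 i) (g.1 i))).trans_le
      (eLpNorm_add_le (f.1 i).aestronglyMeasurable (g.1 i).aestronglyMeasurable (by norm_num))
  smul_mem' := by
    rintro ⟨z, N, hN⟩ f hf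
    have h := ENNReal.Tendsto.const_mul (a := (N.toNNReal : ENNReal)) hf (Or.inr (by simp))
    rw [mul_zero] at h
    refine tendsto_of_tendsto_of_tendsto_of_le_of_le tendsto_const_nhds h (fun _ => zero_le)
      fun i => ?_
    refine (eLpNorm_congr_ae (AEEqFun.coeFn_mul (z i) (f.1 i))).trans_le ?_
    refine eLpNorm_le_nnreal_smul_eLpNorm_of_ae_le_mul ?_ 2
    filter_upwards [hN i] with x hx
    rw [Pi.mul_apply, nnnorm_mul]
    gcongr
    exact NNReal.le_toNNReal_of_coe_le hx

/-- The ultraproduct of the tracial von Neumann algebras `L^∞(X_i, μ_i)`: uniformly bounded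
sequences modulo sequences which tend to `0` in `L²` along `U`. -/
noncomputable abbrev UltraAlgebra (U : Ultrafilter ℕ) (μ : ∀ i, Measure (X i)) : Type _ :=
  BddSeq μ ⧸ nullIdeal U μ

/-- The ultralimit of a uniformly bounded sequence. -/
noncomputable def ulim (U : Ultrafilter ℕ) (μ : ∀ i, Measure (X i)) (f : BddSeq μ) : UltraAlgebra U μ :=
  Ideal.Quotient.mk (nullIdeal U μ) f

variable {Γ : Type*} [Group Γ] [∀ i, MulAction Γ (X i)] (μ : ∀ i, Measure (X i))

/-- The action of `γ` on sequences of functions. -/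
noncomputable def seqTranslate [∀ i, MeasurableConstSMul Γ (X i)]
    [∀ i, SMulInvariantMeasure Γ (X i) (μ i)] (γ : Γ) (f : BddSeq μ) : BddSeq μ :=
  ⟨fun i => translate (μ i) γ (f.1 i), by
    obtain ⟨N, hN⟩ := f.2
    exact ⟨N, fun i => ae_norm_translate γ (hN i)⟩⟩

/-- The sequence of the characteristic functions of the fixed-point sets of `δ`. -/
noncomputable def seqFix [∀ i, FixNullMeasurable Γ (X i) (μ i)] (δ : Γ) : BddSeq μ :=
  ⟨fun i => fixIndicator (μ i) δ, ⟨1, fun _ => ae_norm_fixIndicator δ⟩⟩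

end Ultraproduct

section IsUltraproduct

variable (n u : ℕ) {X : ℕ → Type v} [∀ i, MeasurableSpace (X i)]
  [∀ i, MulAction (FreePower n u) (X i)] [∀ i, MeasurableConstSMul (FreePower n u) (X i)]
  {Ω : Type w} [MeasurableSpace Ω] [MulAction (FreePower n u) Ω]
  [MeasurableConstSMul (FreePower n u) Ω]

/-- `Φ` is an isomorphism from the ultraproduct of the continuous models
`M(a_i) = (L^∞(X_i, μ_i), γ₁, …, γₙ, (1_fix(δ))_δ)` to the continuous model of the action on
`(Ω, ν)`. The involution, the trace, the automorphisms `γ_j` and the constants `1_fix(δ)` of the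
ultraproduct are the ultralimits of those of the factors. -/
structure IsModelIso (U : Ultrafilter ℕ) (μ : ∀ i, Measure (X i))
    [∀ i, SMulInvariantMeasure (FreePower n u) (X i) (μ i)]
    [∀ i, FixNullMeasurable (FreePower n u) (X i) (μ i)]
    (ν : Measure Ω) [SMulInvariantMeasure (FreePower n u) Ω ν]
    [FixNullMeasurable (FreePower n u) Ω ν]
    (Φ : UltraAlgebra U μ ≃ₐ[ℂ] Linf ν) : Prop where
  map_star : ∀ f : BddSeq μ, Φ (ulim U μ (star f)) = star (Φ (ulim U μ f))
  map_trace : ∀ f : BddSeq μ,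
    Tendsto (fun i => trace (μ i) (f.1 i)) U (𝓝 (trace ν (Φ (ulim U μ f)).1))
  map_translate : ∀ (j : Fin n) (f : BddSeq μ),
    (Φ (ulim U μ (seqTranslate μ (gen j : FreePower n u) f))).1 =
      translate ν (gen j : FreePower n u) (Φ (ulim U μ f)).1
  map_fix : ∀ δ : FreePower n u, (Φ (ulim U μ (seqFix μ δ))).1 = fixIndicator ν δ

/-- The action on `(Ω, ν)` is an ultraproduct along `U` of the actions on `(X_i, μ_i)`: its
continuous model is isomorphic to the ultraproduct of their continuous models. -/
def IsUltraproduct (U : Ultrafilter ℕ) (μ : ∀ i, Measure (X i))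
    [∀ i, SMulInvariantMeasure (FreePower n u) (X i) (μ i)]
    [∀ i, FixNullMeasurable (FreePower n u) (X i) (μ i)]
    (ν : Measure Ω) [SMulInvariantMeasure (FreePower n u) Ω ν]
    [FixNullMeasurable (FreePower n u) Ω ν] : Prop :=
  ∃ Φ : UltraAlgebra U μ ≃ₐ[ℂ] Linf ν, IsModelIso n u U μ ν Φ

end IsUltraproduct

end LocalGlobal

namespace LocalGlobal

/-! ## The ball around a point is determined by finitely many relations -/

section Pattern

variable {n u : ℕ}

/-! The type of the ball of radius `r` around `x` depends on finitely many data: which elements of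
the finite set `testSet n u r` fix `x`, and the labels of the translates of `x` by these elements
(`hasType_iff_pattern_mem`). So the set of points of a given type is a finite Boolean combination of
translates of label classes and of fixed-point sets, by a formula which is the same for all actions.

Let `Φ` be the isomorphism of continuous models. `Matched Φ A B` says that `Φ` carries the class of
the indicators of `A i` to the indicator of `B`. This relation passes to complements, finite
intersections and translates, and it holds for fixed-point sets. Since `Φ` preserves the trace,
matched sets have converging measures. Hence matched labellings have converging local statistics
(`tendsto_localStatistics`).

It remains to move labellings through `Φ`. A labelling by `Fin k` is a bounded function killed by
`labelPoly k`, and polynomial identities survive in the ultraproduct, so a sequence of labellings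
has a labelling as its limit (`exists_limit_label`). Conversely, if `h` represents the preimage of a
labelling, then `labelPoly k` of `h i` tends to 0 in L². Rounding moves `h i` by at most a constant
times this quantity, so the rounded functions are labellings in the same class
(`exists_lift_label`).

Thus the exact statistics of the ultraproduct are precisely the limits of exact statistics of the
factors. As they form a totally bounded set, this gives Hausdorff convergence
(`tendsto_closeds_closure`). -/

theorem gen_pow_self (j : Fin n) : (gen j : FreePower n u) ^ u = 1 := by
  rw [gen, ← map_pow, ← ofAdd_nsmul]
  simp

theorem gen_pow_mod (j : Fin n) (m : ℕ) :
    (gen j : FreePower n u) ^ (m % u) = (gen j : FreePower n u) ^ m := by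
  conv_rhs => rw [← Nat.mod_add_div m u, pow_add, pow_mul, gen_pow_self, one_pow, mul_one]

variable {X Y : Type*}

/-- The orbit of `x` under the generator `γ_j` has `u` elements. -/
def FreeAt (u : ℕ) [MulAction (FreePower n u) X] (j : Fin n) (x : X) : Prop :=
  ∀ m : ℕ, 0 < m → m < u → (gen j : FreePower n u) ^ m • x ≠ x

/-- The orbit of `x` under the generator `γ_j`. -/
def genOrbit (u : ℕ) [MulAction (FreePower n u) X] (j : Fin n) (x : X) : Set X :=
  {y | ∃ m : ℕ, m < u ∧ y = (gen j : FreePower n u) ^ m • x}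

variable [MulAction (FreePower n u) X] [MulAction (FreePower n u) Y]

theorem FreeAt.pow_smul {j : Fin n} {x : X} (h : FreeAt u j x) (m : ℕ) :
    FreeAt u j ((gen j : FreePower n u) ^ m • x) := by
  intro i h0 hi hix
  refine h i h0 hi ?_
  rw [smul_smul, ← pow_add, add_comm, pow_add, mul_smul] at hix
  exact MulAction.injective _ hix

variable [NeZero u]

theorem pow_smul_mem_genOrbit (j : Fin n) (x : X) (m : ℕ) :
    (gen j : FreePower n u) ^ m • x ∈ genOrbit u j x :=
  ⟨m % u, Nat.mod_lt _ (NeZero.pos u), by rw [gen_pow_mod]⟩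

theorem mem_genOrbit_self (j : Fin n) (x : X) : x ∈ genOrbit u j x := by
  simpa using pow_smul_mem_genOrbit j x 0

theorem genOrbit_pow_smul (j : Fin n) (x : X) {m : ℕ} (hm : m < u) :
    genOrbit u j ((gen j : FreePower n u) ^ m • x) = genOrbit u j x := by
  ext y
  constructor
  · rintro ⟨i, -, rfl⟩
    rw [smul_smul, ← pow_add]
    exact pow_smul_mem_genOrbit (u := u) j x _
  · rintro ⟨i, -, rfl⟩
    -- The exponent `u - m` undoes the shift by `m`, because the generator has `u`-th power 1.
    have := pow_smul_mem_genOrbit (u := u) j ((gen j : FreePower n u) ^ m • x) (i + (u - m))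
    rwa [smul_smul, ← pow_add, add_assoc, Nat.sub_add_cancel hm.le, pow_add, gen_pow_self,
      mul_one] at this

/-- Any vertex of an edge can serve as its base point, since freeness and the orbit do not change
along the orbit. -/
theorem exists_eq_genOrbit {e : Set X} (he : e ∈ (schreier n u X).edgeSet) {z : X} (hz : z ∈ e) :
    ∃ j : Fin n, FreeAt u j z ∧ e = genOrbit u j z := by
  obtain ⟨j, x, hx, rfl⟩ := he
  obtain ⟨m, hm, rfl⟩ := hz
  exact ⟨j, FreeAt.pow_smul hx m, (genOrbit_pow_smul j x hm).symm⟩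

omit [NeZero u] in
theorem genOrbit_mem_edgeSet {j : Fin n} {z : X} (hz : FreeAt u j z) :
    genOrbit u j z ∈ (schreier n u X).edgeSet := ⟨j, z, hz, rfl⟩

theorem schreier_adj_iff {z y : X} :
    (schreier n u X).Adj z y ↔
      ∃ (j : Fin n) (m : ℕ), m < u ∧ FreeAt u j z ∧ y = (gen j : FreePower n u) ^ m • z := by
  constructor
  · rintro ⟨e, he, hz, hy⟩
    obtain ⟨j, hj, rfl⟩ := exists_eq_genOrbit he hz
    obtain ⟨m, hm, rfl⟩ := hy
    exact ⟨j, m, hm, hj, rfl⟩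
  · rintro ⟨j, m, hm, hj, rfl⟩
    exact ⟨_, genOrbit_mem_edgeSet hj, mem_genOrbit_self j z, m, hm, rfl⟩

/-- Products of at most `r` powers of generators. -/
def wordBall (n u : ℕ) : ℕ → Set (FreePower n u)
  | 0 => {1}
  | r + 1 => wordBall n u r ∪ ⋃ (j : Fin n) (m : Fin u),
      (fun w => (gen j : FreePower n u) ^ (m : ℕ) * w) '' wordBall n u r

omit [NeZero u] in
theorem finite_wordBall (r : ℕ) : (wordBall n u r).Finite := by
  induction r with
  | zero => exact Set.finite_singleton _
  | succ r ih => exact ih.union (Set.finite_iUnion fun j => Set.finite_iUnion fun m => ih.image _)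

omit [NeZero u] in
theorem wordBall_mono : Monotone (wordBall n u) :=
  monotone_nat_of_le_succ fun _ => Set.subset_union_left

omit [NeZero u] in
theorem one_mem_wordBall (r : ℕ) : 1 ∈ wordBall n u r := wordBall_mono (Nat.zero_le r) rfl

omit [NeZero u] in
theorem pow_mul_mem_wordBall {r : ℕ} (j : Fin n) {m : ℕ} (hm : m < u) {a : FreePower n u}
    (ha : a ∈ wordBall n u r) : (gen j : FreePower n u) ^ m * a ∈ wordBall n u (r + 1) :=
  Or.inr (Set.mem_iUnion₂.2 ⟨j, ⟨m, hm⟩, a, ha, rfl⟩)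

/-- Each step along an edge is a power of one generator, so distance in the hypergraph bounds word
length. -/
theorem exists_smul_eq_of_mem_ballSet {x : X} {r : ℕ} {y : X}
    (hy : y ∈ ballSet (schreier n u X) x r) : ∃ a ∈ wordBall n u r, a • x = y := by
  induction r generalizing y with
  | zero => exact ⟨1, rfl, by rw [one_smul]; exact hy.symm⟩
  | succ r ih =>
    rcases hy with hy | ⟨z, hz, hzy⟩
    · obtain ⟨a, ha, rfl⟩ := ih hy
      exact ⟨a, Or.inl ha, rfl⟩
    · obtain ⟨a, ha, rfl⟩ := ih hz
      obtain ⟨j, m, hm, -, rfl⟩ := schreier_adj_iff.1 hzy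
      exact ⟨_, pow_mul_mem_wordBall j hm ha, mul_smul _ _ _⟩

/-- The points `x` and `y` satisfy the same relations of length at most `N`, and the values of the
labellings `f` and `g` correspond. -/
structure Indist (n u : ℕ) [MulAction (FreePower n u) X] [MulAction (FreePower n u) Y]
    {A : Type*} (N : ℕ) (f : X → A) (g : Y → A) (x : X) (y : Y) : Prop where
  rel : ∀ a ∈ wordBall n u N, ∀ b ∈ wordBall n u N, a • x = b • x ↔ a • y = b • y
  label : ∀ a ∈ wordBall n u N, f (a • x) = g (a • y)

namespace Indist

variable {A : Type} {N r : ℕ} {f : X → A} {g : Y → A} {x : X} {y : Y}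

omit [NeZero u] in
theorem symm (h : Indist n u N f g x y) : Indist n u N g f y x :=
  ⟨fun a ha b hb => (h.rel a ha b hb).symm, fun a ha => (h.label a ha).symm⟩

omit [NeZero u] in
theorem freeAt (h : Indist n u (r + 1) f g x y) {j : Fin n} {a : FreePower n u}
    (ha : a ∈ wordBall n u r) (hx : FreeAt u j (a • x)) : FreeAt u j (a • y) := by
  intro m h0 hm he
  refine hx m h0 hm ?_
  rw [smul_smul] at he ⊢
  exact (h.rel _ (pow_mul_mem_wordBall j hm ha) _ (Or.inl ha)).2 he

theorem mem_ballSet (h : Indist n u (r + 1) f g x y) {s : ℕ} (hs : s ≤ r + 1) {a : FreePower n u}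
    (ha : a ∈ wordBall n u (r + 1)) (hx : a • x ∈ ballSet (schreier n u X) x s) :
    a • y ∈ ballSet (schreier n u Y) y s := by
  induction s generalizing a with
  | zero =>
    have := (h.rel a ha 1 (one_mem_wordBall _)).1 (by rw [one_smul]; exact hx)
    rw [this, one_smul]
    exact rfl
  | succ s ih =>
    rcases hx with hx | ⟨z, hz, hzy⟩
    · exact Or.inl (ih (by omega) ha hx)
    · obtain ⟨b, hb, rfl⟩ := exists_smul_eq_of_mem_ballSet hz
      obtain ⟨j, m, hm, hj, he⟩ := schreier_adj_iff.1 hzy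
      -- The predecessor on the path has length at most `s ≤ r`, which leaves room for one more
      -- letter in a relation of length `r + 1`.
      have hb' : b ∈ wordBall n u r := wordBall_mono (by omega) hb
      refine Or.inr ⟨b • y, ih (by omega) (Or.inl hb') hz, schreier_adj_iff.2
        ⟨j, m, hm, h.freeAt hb' hj, ?_⟩⟩
      rw [smul_smul] at he ⊢
      exact (h.rel _ ha _ (pow_mul_mem_wordBall j hm hb')).1 he

open scoped Classical in
/-- The correspondence `a • x ↦ a • y` for short words `a`. -/
noncomputable def transport (n u : ℕ) [MulAction (FreePower n u) X] [MulAction (FreePower n u) Y]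
    (N : ℕ) (x : X) (y : Y) (z : X) : Y :=
  -- The value `y` off the short words is arbitrary: every point of the ball is reached by a short
  -- word.
  if h : ∃ a ∈ wordBall n u N, a • x = z then h.choose • y else y

omit [NeZero u] in
-- The chosen word may differ from `a`, but two short words agreeing at `x` also agree at `y`.
theorem transport_smul (h : Indist n u N f g x y) {a : FreePower n u} (ha : a ∈ wordBall n u N) :
    transport n u N x y (a • x) = a • y := by
  have hex : ∃ b ∈ wordBall n u N, b • x = a • x := ⟨a, ha, rfl⟩
  rw [transport, dif_pos hex]
  exact (h.rel _ hex.choose_spec.1 a ha).1 hex.choose_spec.2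

omit [NeZero u] in
theorem image_genOrbit (h : Indist n u (r + 1) f g x y) (j : Fin n) {a : FreePower n u}
    (ha : a ∈ wordBall n u r) :
    transport n u (r + 1) x y '' genOrbit u j (a • x) = genOrbit u j (a • y) := by
  ext z
  constructor
  · rintro ⟨_, ⟨m, hm, rfl⟩, rfl⟩
    rw [smul_smul, h.transport_smul (pow_mul_mem_wordBall j hm ha), mul_smul]
    exact ⟨m, hm, rfl⟩
  · rintro ⟨m, hm, rfl⟩
    refine ⟨_, ⟨m, hm, rfl⟩, ?_⟩
    rw [smul_smul, h.transport_smul (pow_mul_mem_wordBall j hm ha), mul_smul]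

theorem genOrbit_subset (h : Indist n u (r + 1) f g x y) {j : Fin n} {a : FreePower n u}
    (ha : a ∈ wordBall n u r) (hx : genOrbit u j (a • x) ⊆ ballSet (schreier n u X) x r) :
    genOrbit u j (a • y) ⊆ ballSet (schreier n u Y) y r := by
  rintro _ ⟨m, hm, rfl⟩
  rw [smul_smul]
  refine h.mem_ballSet (Nat.le_succ r) (pow_mul_mem_wordBall j hm ha) ?_
  rw [mul_smul]
  exact hx ⟨m, hm, rfl⟩

/-- The balls of radius `r` around points with the same relations and labels of length at most
`r + 1` are isomorphic. -/
theorem isomorphic (h : Indist n u (r + 1) f g x y) :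
    Isomorphic (ballAt (schreier n u X) f (diagram n u X) x r)
      (ballAt (schreier n u Y) g (diagram n u Y) y r) := by
  have hr : wordBall n u r ⊆ wordBall n u (r + 1) := wordBall_mono (Nat.le_succ r)
  refine ⟨transport n u (r + 1) x y, ⟨⟨?_, ?_, ?_⟩, ?_, ?_, ?_, ?_⟩⟩
  · intro z hz
    obtain ⟨a, ha, rfl⟩ := exists_smul_eq_of_mem_ballSet hz
    rw [h.transport_smul (hr ha)]
    exact h.mem_ballSet (Nat.le_succ r) (hr ha) hz
  · intro z hz z' hz' he
    obtain ⟨a, ha, rfl⟩ := exists_smul_eq_of_mem_ballSet hz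
    obtain ⟨b, hb, rfl⟩ := exists_smul_eq_of_mem_ballSet hz'
    rw [h.transport_smul (hr ha), h.transport_smul (hr hb)] at he
    exact (h.rel a (hr ha) b (hr hb)).2 he
  · intro z hz
    obtain ⟨a, ha, rfl⟩ := exists_smul_eq_of_mem_ballSet hz
    exact ⟨a • x, h.symm.mem_ballSet (Nat.le_succ r) (hr ha) hz, h.transport_smul (hr ha)⟩
  · ext e
    constructor
    · rintro ⟨he, hsub⟩
      obtain ⟨j, z, hz, rfl⟩ := id he
      change genOrbit u j z ⊆ _ at hsub
      -- The base point lies in its own orbit, hence in the ball, so it has a word of length `r` and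
      -- the whole edge has words of length `r + 1`.
      obtain ⟨a, ha, rfl⟩ := exists_smul_eq_of_mem_ballSet (hsub (mem_genOrbit_self j z))
      exact ⟨genOrbit u j (a • x), ⟨genOrbit_mem_edgeSet (h.symm.freeAt ha hz),
        h.symm.genOrbit_subset ha hsub⟩, h.image_genOrbit j ha⟩
    · rintro ⟨e, ⟨he, hsub⟩, rfl⟩
      obtain ⟨j, z, hz, rfl⟩ := id he
      change genOrbit u j z ⊆ _ at hsub
      obtain ⟨a, ha, rfl⟩ := exists_smul_eq_of_mem_ballSet (hsub (mem_genOrbit_self j z))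
      have hi := h.image_genOrbit j ha
      change transport n u (r + 1) x y '' genOrbit u j (a • x) ∈ _
      rw [hi]
      exact ⟨genOrbit_mem_edgeSet (h.freeAt ha hz), h.genOrbit_subset ha hsub⟩
  · have := h.transport_smul (one_mem_wordBall (r + 1))
    rwa [one_smul, one_smul] at this
  · intro z hz
    obtain ⟨a, ha, rfl⟩ := exists_smul_eq_of_mem_ballSet hz
    rw [h.transport_smul (hr ha)]
    exact (h.label a (hr ha)).symm
  · intro z hz
    have hz' : ∀ i, ∃ a ∈ wordBall n u r, a • x = z i := fun i =>
      exists_smul_eq_of_mem_ballSet (hz.2.2 (Set.mem_range_self i))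
    choose a ha hza using hz'
    ext l
    refine forall_congr' fun m => ?_
    -- The diagram compares a generator power of one vertex with another vertex; this extra letter
    -- is again why relations of length `r + 1` are needed.
    have hm : (gen l.1 : FreePower n u) ^ (l.2 m : ℕ) * a 0 ∈ wordBall n u (r + 1) :=
      pow_mul_mem_wordBall l.1 (l.2 m).2 (ha 0)
    rw [Function.comp_apply, Function.comp_apply, ← hza 0, ← hza m, h.transport_smul (hr (ha _)),
      h.transport_smul (hr (ha _)), smul_smul, smul_smul]
    exact (h.rel _ hm _ (hr (ha _))).symm

end Indist

omit [NeZero u] in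
theorem HasType.congr {A B : Type} {V W : Type*} {r d : ℕ} {G : RootedLabelled u A B V}
    {H : RootedLabelled u A B W} (h : Isomorphic G H) {c : LocalType r d u A B} :
    HasType G c ↔ HasType H c :=
  ⟨fun ⟨K, hK, hi⟩ => ⟨K, hK, hi.trans h⟩, fun ⟨K, hK, hi⟩ => ⟨K, hK, hi.trans h.symm⟩⟩

/-- The group elements on which the isomorphism type of a ball of radius `r` depends. -/
def testSet (n u r : ℕ) : Set (FreePower n u) :=
  Set.image2 (fun a b => a⁻¹ * b) (wordBall n u (r + 1)) (wordBall n u (r + 1))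

instance finite_testSet (r : ℕ) : Finite (testSet n u r) :=
  ((finite_wordBall _).image2 _ (finite_wordBall _)).to_subtype

/-- The labels of the translates of `x` by the elements of `testSet n u r`, and the set of those
elements which fix `x`. -/
def pattern {A : Type*} (n u : ℕ) [MulAction (FreePower n u) X] (r : ℕ) (f : X → A) (x : X) : testSet n u r → A × Prop :=
  fun δ => (f (δ.1 • x), x ∈ MulAction.fixedBy X δ.1)

omit [NeZero u] in
theorem indist_of_pattern_eq {A : Type} {r : ℕ} {f : X → A} {g : Y → A} {x : X} {y : Y}
    (h : pattern n u r f x = pattern n u r g y) : Indist n u (r + 1) f g x y := by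
  constructor
  · intro a ha b hb
    have h1 := congrArg Prod.snd (congrFun h ⟨_, a, ha, b, hb, rfl⟩)
    simp only [pattern, MulAction.mem_fixedBy, mul_smul, inv_smul_eq_iff, eq_iff_iff] at h1
    rw [eq_comm, h1, eq_comm]
  · intro a ha
    -- The test set contains every short word `a`, as `1⁻¹ * a`, so labels can be read off too.
    have h1 := congrArg Prod.fst (congrFun h ⟨_, 1, one_mem_wordBall _, a, ha, rfl⟩)
    simpa [pattern] using h1

/-- The patterns which force the ball of radius `r` to have type `c`. -/
def patternsOf {A : Type} (r : ℕ) (c : LocalType r n u A (Set (DiagramLabel n u))) :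
    Set (testSet n u r → A × Prop) :=
  -- Coset spaces model all pointed orbits, so this set of patterns refers to no particular action
  -- or universe and serves all factors and the ultraproduct at once.
  {p | ∃ (H : Subgroup (FreePower n u)) (f : FreePower n u ⧸ H → A),
    pattern n u r f (1 : FreePower n u) = p ∧ HasType (ballAt (schreier n u (FreePower n u ⧸ H)) f
      (diagram n u (FreePower n u ⧸ H)) (1 : FreePower n u) r) c}

/-- The isomorphism type of the ball of radius `r` around `x` depends only on the pattern of `x`. -/
theorem hasType_iff_pattern_mem {A : Type} {r : ℕ} (f : X → A) (x : X)
    (c : LocalType r n u A (Set (DiagramLabel n u))) :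
    HasType (ballAt (schreier n u X) f (diagram n u X) x r) c ↔
      pattern n u r f x ∈ patternsOf r c := by
  constructor
  · intro h
    -- Pull the labelling back along the orbit map from the cosets of the stabilizer of `x`; the
    -- trivial coset then has the pattern of `x`.
    have hp : pattern n u r
        (fun q => f (MulAction.ofQuotientStabilizer (FreePower n u) x q))
        ((1 : FreePower n u) : FreePower n u ⧸ MulAction.stabilizer (FreePower n u) x) =
        pattern n u r f x := by
      funext δ
      simp only [pattern, MulAction.mem_fixedBy, MulAction.Quotient.smul_coe, smul_eq_mul,
        mul_one, MulAction.ofQuotientStabilizer_mk, Prod.mk.injEq, true_and, eq_iff_iff]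
      rw [eq_comm, QuotientGroup.eq, inv_one, one_mul, MulAction.mem_stabilizer_iff]
    exact ⟨_, _, hp, (HasType.congr (indist_of_pattern_eq hp).isomorphic).2 h⟩
  · rintro ⟨H, g, hp, hg⟩
    exact (HasType.congr (indist_of_pattern_eq hp).isomorphic).1 hg

end Pattern

/-! ## Sets which correspond to each other under an isomorphism with an ultraproduct -/

section Indicator

variable {X : Type*} [MeasurableSpace X]

/-- The characteristic function of a set, as an element of `L^∞`. -/
noncomputable def linfIndicator (μ : Measure X) (A : Set X) (hA : NullMeasurableSet A μ) :
    Linf μ :=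
  ⟨AEEqFun.mk (A.indicator fun _ => 1) (aestronglyMeasurable_const.indicator₀ hA), 1, by
    filter_upwards [AEEqFun.coeFn_mk (A.indicator fun _ => (1 : ℂ))
      (aestronglyMeasurable_const.indicator₀ hA)] with x hx
    rw [hx]
    exact (norm_indicator_le_norm_self _ _).trans (by simp)⟩

variable {μ : Measure X} {A B : Set X}

theorem coeFn_linfIndicator (hA : NullMeasurableSet A μ) :
    (linfIndicator μ A hA).1 =ᵐ[μ] A.indicator fun _ => 1 :=
  AEEqFun.coeFn_mk _ _

theorem ae_norm_linfIndicator (hA : NullMeasurableSet A μ) :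
    ∀ᵐ x ∂μ, ‖(linfIndicator μ A hA).1 x‖ ≤ 1 := by
  filter_upwards [coeFn_linfIndicator hA] with x hx
  rw [hx]
  exact (norm_indicator_le_norm_self _ _).trans (by simp)

theorem linfIndicator_compl (hA : NullMeasurableSet A μ) :
    linfIndicator μ Aᶜ hA.compl = 1 - linfIndicator μ A hA := by
  refine Subtype.ext (AEEqFun.ext ?_)
  change _ =ᵐ[μ] ⇑((1 : X →ₘ[μ] ℂ) - (linfIndicator μ A hA).1)
  filter_upwards [coeFn_linfIndicator hA.compl, coeFn_linfIndicator hA,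
    AEEqFun.coeFn_sub (1 : X →ₘ[μ] ℂ) (linfIndicator μ A hA).1,
    AEEqFun.coeFn_one (μ := μ) (β := ℂ)] with x h1 h2 h3 h4
  rw [h1, h3, Pi.sub_apply, h2, h4]
  by_cases hx : x ∈ A <;> simp [hx]

theorem linfIndicator_inter (hA : NullMeasurableSet A μ) (hB : NullMeasurableSet B μ) :
    linfIndicator μ (A ∩ B) (hA.inter hB) = linfIndicator μ A hA * linfIndicator μ B hB := by
  refine Subtype.ext (AEEqFun.ext ?_)
  change _ =ᵐ[μ] ⇑((linfIndicator μ A hA).1 * (linfIndicator μ B hB).1)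
  filter_upwards [coeFn_linfIndicator (hA.inter hB), coeFn_linfIndicator hA,
    coeFn_linfIndicator hB,
    AEEqFun.coeFn_mul (linfIndicator μ A hA).1 (linfIndicator μ B hB).1] with x h1 h2 h3 h4
  rw [h1, h4, Pi.mul_apply, h2, h3]
  by_cases hx : x ∈ A <;> by_cases hx' : x ∈ B <;> simp [hx, hx']

theorem linfIndicator_univ (μ : Measure X) :
    linfIndicator μ Set.univ MeasurableSet.univ.nullMeasurableSet = 1 := by
  refine Subtype.ext (AEEqFun.ext ?_)
  filter_upwards [coeFn_linfIndicator (μ := μ) MeasurableSet.univ.nullMeasurableSet,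
    AEEqFun.coeFn_one (μ := μ) (β := ℂ)] with x h1 h2
  exact h1.trans ((Set.indicator_of_mem (Set.mem_univ x) _).trans h2.symm)

theorem trace_linfIndicator (hA : NullMeasurableSet A μ) :
    trace μ (linfIndicator μ A hA).1 = (μ.real A : ℂ) := by
  rw [trace, integral_congr_ae (coeFn_linfIndicator hA), integral_indicator₀ hA]
  simp

variable {Γ : Type*} [Group Γ] [MulAction Γ X] [MeasurableConstSMul Γ X]
  [SMulInvariantMeasure Γ X μ]

theorem nullMeasurableSet_preimage_smul (hA : NullMeasurableSet A μ) (γ : Γ) :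
    NullMeasurableSet ((γ • ·) ⁻¹' A) μ :=
  hA.preimage (measurePreserving_smul γ μ).quasiMeasurePreserving

omit [MeasurableSpace X] [MeasurableConstSMul Γ X] in
theorem preimage_mul_smul (γ δ : Γ) (A : Set X) :
    ((γ * δ) • ·) ⁻¹' A = (δ • ·) ⁻¹' ((γ • ·) ⁻¹' A) := by
  ext x
  simp [mul_smul]

theorem translate_linfIndicator (hA : NullMeasurableSet A μ) (γ : Γ) :
    translate μ γ (linfIndicator μ A hA).1 =
      (linfIndicator μ ((γ⁻¹ • ·) ⁻¹' A) (nullMeasurableSet_preimage_smul hA γ⁻¹)).1 :=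
  AEEqFun.compMeasurePreserving_mk _ _

end Indicator

/-! ### Boolean operations, measures and translates of matched sets -/

section Matched

variable {n u : ℕ} {X : ℕ → Type v} [∀ i, MeasurableSpace (X i)]
  {Ω : Type w} [MeasurableSpace Ω]
  {U : Ultrafilter ℕ} {μ : ∀ i, Measure (X i)} {ν : Measure Ω}

/-- The sequence of the characteristic functions of a sequence of sets. -/
noncomputable def seqIndicator (μ : ∀ i, Measure (X i)) (A : ∀ i, Set (X i))
    (hA : ∀ i, NullMeasurableSet (A i) (μ i)) : BddSeq μ :=
  ⟨fun i => (linfIndicator (μ i) (A i) (hA i)).1, 1, fun i => ae_norm_linfIndicator (hA i)⟩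

/-- The isomorphism `Φ` sends the class of a sequence of sets to the class of the set `B`. -/
structure Matched (Φ : UltraAlgebra U μ ≃ₐ[ℂ] Linf ν) (A : ∀ i, Set (X i)) (B : Set Ω) :
    Prop where
  nullMeasurableSet_seq : ∀ i, NullMeasurableSet (A i) (μ i)
  nullMeasurableSet : NullMeasurableSet B ν
  eq : Φ (ulim U μ (seqIndicator μ A nullMeasurableSet_seq)) = linfIndicator ν B nullMeasurableSet

namespace Matched

variable {Φ : UltraAlgebra U μ ≃ₐ[ℂ] Linf ν} {A A' : ∀ i, Set (X i)} {B B' : Set Ω}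

theorem compl (h : Matched Φ A B) : Matched Φ (fun i => (A i)ᶜ) Bᶜ := by
  refine ⟨fun i => (h.1 i).compl, h.2.compl, ?_⟩
  have : seqIndicator μ (fun i => (A i)ᶜ) (fun i => (h.1 i).compl) =
      1 - seqIndicator μ A h.1 :=
    Subtype.ext (funext fun i => congrArg Subtype.val (linfIndicator_compl (h.1 i)))
  rw [this, ulim, map_sub, map_one, map_sub, map_one, linfIndicator_compl h.2, ← h.eq, ulim]

theorem inter (h : Matched Φ A B) (h' : Matched Φ A' B') :
    Matched Φ (fun i => A i ∩ A' i) (B ∩ B') := by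
  refine ⟨fun i => (h.1 i).inter (h'.1 i), h.2.inter h'.2, ?_⟩
  have : seqIndicator μ (fun i => A i ∩ A' i) (fun i => (h.1 i).inter (h'.1 i)) =
      seqIndicator μ A h.1 * seqIndicator μ A' h'.1 :=
    Subtype.ext (funext fun i => congrArg Subtype.val (linfIndicator_inter (h.1 i) (h'.1 i)))
  rw [this, ulim, map_mul, map_mul, linfIndicator_inter h.2 h'.2, ← h.eq, ← h'.eq, ulim, ulim]

theorem univ : Matched Φ (fun _ => Set.univ) Set.univ := by
  refine ⟨fun i => MeasurableSet.univ.nullMeasurableSet,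
    MeasurableSet.univ.nullMeasurableSet, ?_⟩
  have h2 : seqIndicator μ (fun _ => Set.univ)
      (fun _ => MeasurableSet.univ.nullMeasurableSet) = 1 :=
    Subtype.ext (funext fun i => congrArg Subtype.val (linfIndicator_univ (μ i)))
  rw [h2, ulim, map_one, map_one, linfIndicator_univ]

theorem iInter {ι : Type*} [Finite ι] {A : ι → ∀ i, Set (X i)} {B : ι → Set Ω}
    (h : ∀ j, Matched Φ (A j) (B j)) : Matched Φ (fun i => ⋂ j, A j i) (⋂ j, B j) := by
  classical
  have := Fintype.ofFinite ι
  have key : ∀ s : Finset ι, Matched Φ (fun i => ⋂ j ∈ s, A j i) (⋂ j ∈ s, B j) := by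
    intro s
    induction s using Finset.induction_on with
    | empty => simpa using univ
    | insert a s _ ih => simpa using (h a).inter ih
  simpa using key Finset.univ

theorem iUnion {ι : Type*} [Finite ι] {A : ι → ∀ i, Set (X i)} {B : ι → Set Ω}
    (h : ∀ j, Matched Φ (A j) (B j)) : Matched Φ (fun i => ⋃ j, A j i) (⋃ j, B j) := by
  simpa [Set.compl_iInter] using (iInter fun j => (h j).compl).compl

variable [∀ i, MulAction (FreePower n u) (X i)] [∀ i, MeasurableConstSMul (FreePower n u) (X i)]
  [MulAction (FreePower n u) Ω] [MeasurableConstSMul (FreePower n u) Ω]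
  [∀ i, SMulInvariantMeasure (FreePower n u) (X i) (μ i)]
  [∀ i, FixNullMeasurable (FreePower n u) (X i) (μ i)]
  [SMulInvariantMeasure (FreePower n u) Ω ν] [FixNullMeasurable (FreePower n u) Ω ν]

/-- The trace of an indicator is the measure of the set, so preservation of the trace is convergence
of measures. -/
theorem tendsto_measure (hΦ : IsModelIso n u U μ ν Φ) (h : Matched Φ A B) :
    Tendsto (fun i => (μ i).real (A i)) U (𝓝 (ν.real B)) := by
  have h1 := hΦ.map_trace (seqIndicator μ A h.1)
  rw [h.eq, trace_linfIndicator] at h1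
  have h2 := (Complex.continuous_re.tendsto _).comp h1
  rw [Complex.ofReal_re] at h2
  refine h2.congr fun i => ?_
  exact congrArg Complex.re (trace_linfIndicator (h.1 i))

theorem fixedBy (hΦ : IsModelIso n u U μ ν Φ) (δ : FreePower n u) :
    Matched Φ (fun i => MulAction.fixedBy (X i) δ) (MulAction.fixedBy Ω δ) :=
  ⟨fun _ => FixNullMeasurable.nullMeasurableSet_fixedBy δ,
    FixNullMeasurable.nullMeasurableSet_fixedBy δ, Subtype.ext (hΦ.map_fix δ)⟩

theorem preimage_gen_inv (hΦ : IsModelIso n u U μ ν Φ) (j : Fin n) (h : Matched Φ A B) :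
    Matched Φ (fun i => ((gen j : FreePower n u)⁻¹ • ·) ⁻¹' A i)
      (((gen j : FreePower n u)⁻¹ • ·) ⁻¹' B) := by
  refine ⟨fun i => nullMeasurableSet_preimage_smul (h.1 i) _,
    nullMeasurableSet_preimage_smul h.2 _, Subtype.ext ?_⟩
  rw [← translate_linfIndicator h.2, ← h.eq, ← hΦ.map_translate]
  have : seqIndicator μ (fun i => ((gen j : FreePower n u)⁻¹ • ·) ⁻¹' A i)
      (fun i => nullMeasurableSet_preimage_smul (h.1 i) _) =
      seqTranslate μ (gen j : FreePower n u) (seqIndicator μ A h.1) :=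
    Subtype.ext (funext fun i => (translate_linfIndicator (h.1 i) (gen j)).symm)
  rw [this]

/-- The isomorphism is only assumed to respect the generators. As `u ≠ 0`, elements of the cyclic
factors are natural powers of generators, so words in them exhaust the group. -/
theorem preimage_smul [NeZero u] (hΦ : IsModelIso n u U μ ν Φ) (h : Matched Φ A B)
    (δ : FreePower n u) : Matched Φ (fun i => (δ • ·) ⁻¹' A i) ((δ • ·) ⁻¹' B) := by
  -- Translation by `γ` pulls sets back along `γ⁻¹`. The induction must vary the sets, since for a
  -- product one preimage is taken of another.
  obtain ⟨γ, rfl⟩ : ∃ γ, γ⁻¹ = δ := ⟨δ⁻¹, inv_inv δ⟩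
  induction γ using Monoid.CoprodI.induction_on generalizing A B with
  | one => simpa using h
  | of j m =>
    have hm : (Monoid.CoprodI.of (i := j) m : FreePower n u) =
        gen j ^ (Multiplicative.toAdd m).val := by
      rw [gen, ← map_pow, ← ofAdd_nsmul]
      simp
    rw [hm]
    induction (Multiplicative.toAdd m).val with
    | zero => simpa using h
    | succ l ih =>
      simp only [pow_succ', mul_inv_rev, preimage_mul_smul]
      exact preimage_gen_inv hΦ j ih
  | mul x y hx hy =>
    simp only [mul_inv_rev, preimage_mul_smul]
    exact hx (hy h)

end Matched

end Matched

/-! ## Labellings as elements of the algebra of functions -/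

section Labelling

variable {k : ℕ}

/-- The polynomial with simple roots `0, …, k - 1`. -/
noncomputable def labelPoly (k : ℕ) : Polynomial ℂ :=
  ∏ j : Fin k, (Polynomial.X - Polynomial.C ((j : ℕ) : ℂ))

theorem eval_labelPoly (z : ℂ) :
    (labelPoly k).eval z = ∏ j : Fin k, (z - ((j : ℕ) : ℂ)) := by
  simp [labelPoly, Polynomial.eval_prod]

theorem eval_labelPoly_natCast (j : Fin k) : (labelPoly k).eval ((j : ℕ) : ℂ) = 0 := by
  rw [eval_labelPoly]
  exact Finset.prod_eq_zero (Finset.mem_univ j) (sub_self _)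

/-- The polynomial which is `1` at `j` and `0` at the other numbers below `k`. -/
noncomputable def indicatorPoly (j : Fin k) : Polynomial ℂ :=
  Lagrange.basis Finset.univ (fun i : Fin k => ((i : ℕ) : ℂ)) j

theorem eval_indicatorPoly (i j : Fin k) :
    (indicatorPoly j).eval ((i : ℕ) : ℂ) = if i = j then 1 else 0 := by
  split_ifs with h
  · subst h
    refine Lagrange.eval_basis_self (v := fun i : Fin k => ((i : ℕ) : ℂ)) ?_ (Finset.mem_univ i)
    intro a _ b _ hab
    exact Fin.ext (by simpa using hab)
  · exact Lagrange.eval_basis_of_ne (v := fun i : Fin k => ((i : ℕ) : ℂ)) (Ne.symm h)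
      (Finset.mem_univ i)

/-- Rounding a complex number to a nearest number below `k`. -/
theorem exists_measurable_round (hk : 0 < k) :
    ∃ F : ℂ → Fin k, Measurable F ∧
      ∀ z, ‖z - ((F z : ℕ) : ℂ)‖ ≤ 2 ^ k * ‖(labelPoly k).eval z‖ := by
  set e : ℕ → ℂ := fun i => (i : ℂ) with he
  have hle : ∀ z, SimpleFunc.nearestPtInd e (k - 1) z < k := fun z =>
    (SimpleFunc.nearestPtInd_le e (k - 1) z).trans_lt (by omega)
  refine ⟨fun z => ⟨SimpleFunc.nearestPtInd e (k - 1) z, hle z⟩, ?_, fun z => ?_⟩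
  · refine measurable_to_countable' fun j => ?_
    convert (SimpleFunc.nearestPtInd e (k - 1)).measurableSet_preimage {(j : ℕ)} using 1
    ext z
    simp [Fin.ext_iff]
  set j₀ : Fin k := ⟨SimpleFunc.nearestPtInd e (k - 1) z, hle z⟩ with hj₀
  have hnear : ∀ j : Fin k, ‖z - ((j₀ : ℕ) : ℂ)‖ ≤ ‖z - ((j : ℕ) : ℂ)‖ := by
    intro j
    have h := SimpleFunc.edist_nearestPt_le e z (show (j : ℕ) ≤ k - 1 by omega)
    rw [edist_dist, edist_dist, ENNReal.ofReal_le_ofReal_iff dist_nonneg, dist_comm,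
      dist_comm (e j), dist_eq_norm, dist_eq_norm] at h
    exact h
  -- Distinct integers are at distance at least 1 and `j₀` is nearest to `z`, so `z` is at distance
  -- at least 1/2 from the others.
  have hfar : ∀ j ∈ Finset.univ.erase j₀, (1 / 2 : ℝ) ≤ ‖z - ((j : ℕ) : ℂ)‖ := by
    intro j hj
    have h1 : (1 : ℝ) ≤ ‖((j : ℕ) : ℂ) - ((j₀ : ℕ) : ℂ)‖ := by
      have h2 : ((j : ℕ) : ℤ) - ((j₀ : ℕ) : ℤ) ≠ 0 := by
        rw [sub_ne_zero]
        exact fun h => (Finset.ne_of_mem_erase hj) (Fin.ext (by exact_mod_cast h))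
      have h3 := Int.one_le_abs h2
      have h4 : ((j : ℕ) : ℂ) - ((j₀ : ℕ) : ℂ) = ((((j : ℕ) : ℤ) - ((j₀ : ℕ) : ℤ) : ℤ) : ℂ) := by
        push_cast
        rfl
      rw [h4, Complex.norm_intCast]
      exact_mod_cast h3
    have h5 : ‖((j : ℕ) : ℂ) - ((j₀ : ℕ) : ℂ)‖ ≤
        ‖z - ((j₀ : ℕ) : ℂ)‖ + ‖z - ((j : ℕ) : ℂ)‖ := by
      refine le_trans (le_of_eq ?_) (norm_sub_le _ _)
      congr 1
      ring
    linarith [hnear j]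
  -- There are only `k - 1` factors; the weaker exponent `k` is harmless and gives the constant `2 ^
  -- k`.
  have hprod : (1 / 2 : ℝ) ^ k ≤ ∏ j ∈ Finset.univ.erase j₀, ‖z - ((j : ℕ) : ℂ)‖ := by
    refine le_trans ?_ (Finset.prod_le_prod (fun _ _ => by norm_num) hfar)
    rw [Finset.prod_const]
    refine pow_le_pow_of_le_one (by norm_num) (by norm_num) ?_
    exact (Finset.card_erase_le).trans (by simp)
  rw [eval_labelPoly, norm_prod, ← Finset.mul_prod_erase _ _ (Finset.mem_univ j₀)]
  calc ‖z - ((j₀ : ℕ) : ℂ)‖ = 2 ^ k * (‖z - ((j₀ : ℕ) : ℂ)‖ * (1 / 2) ^ k) := by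
        rw [mul_left_comm, ← mul_pow]
        norm_num
    _ ≤ _ := by gcongr

variable {X : Type*} [MeasurableSpace X] {μ : Measure X}

theorem coeFn_aeval (p : Polynomial ℂ) (h : X →ₘ[μ] ℂ) :
    (Polynomial.aeval h p : X →ₘ[μ] ℂ) =ᵐ[μ] fun x => p.eval (h x) := by
  induction p using Polynomial.induction_on' with
  | add p q hp hq =>
    rw [map_add]
    filter_upwards [hp, hq, AEEqFun.coeFn_add (Polynomial.aeval h p) (Polynomial.aeval h q)]
      with x h1 h2 h3
    rw [h3, Pi.add_apply, h1, h2, Polynomial.eval_add]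
  | monomial m a =>
    induction m with
    | zero =>
      rw [Polynomial.monomial_zero_left, Polynomial.aeval_C, Algebra.algebraMap_eq_smul_one]
      filter_upwards [AEEqFun.coeFn_smul a (1 : X →ₘ[μ] ℂ), AEEqFun.coeFn_one (μ := μ) (β := ℂ)]
        with x h1 h2
      simp [h1, h2]
    | succ m ih =>
      rw [← Polynomial.monomial_mul_X, map_mul, Polynomial.aeval_X]
      filter_upwards [ih, AEEqFun.coeFn_mul (Polynomial.aeval h (Polynomial.monomial m a)) h]
        with x h1 h2
      rw [h2, Pi.mul_apply, h1, Polynomial.eval_mul, Polynomial.eval_X]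

theorem coe_aeval_linf (p : Polynomial ℂ) (h : Linf μ) :
    (Polynomial.aeval h p).1 = Polynomial.aeval h.1 p :=
  (Polynomial.aeval_algHom_apply (Linf μ).subtype.toAlgHom h p).symm

theorem coe_aeval_bddSeq {X : ℕ → Type*} [∀ i, MeasurableSpace (X i)] {μ : ∀ i, Measure (X i)}
    (p : Polynomial ℂ) (h : BddSeq μ) (i : ℕ) :
    (Polynomial.aeval h p).1 i = Polynomial.aeval (h.1 i) p :=
  (Polynomial.aeval_algHom_apply ((Pi.evalAlgHom ℂ (fun i => X i →ₘ[μ i] ℂ) i).comp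
    (BddSeq μ).subtype.toAlgHom) h p).symm

theorem aestronglyMeasurable_label {f : X → Fin k} (hf : Measurable f) :
    AEStronglyMeasurable (fun x => ((f x : ℕ) : ℂ)) μ :=
  ((measurable_of_countable fun j : Fin k => ((j : ℕ) : ℂ)).comp hf).aestronglyMeasurable

theorem ae_norm_label {f : X → Fin k} (hf : Measurable f) :
    ∀ᵐ x ∂μ, ‖AEEqFun.mk (fun x => ((f x : ℕ) : ℂ)) (aestronglyMeasurable_label hf (μ := μ)) x‖ ≤
      (k : ℝ) := by
  filter_upwards [AEEqFun.coeFn_mk _ (aestronglyMeasurable_label hf (μ := μ))] with x hx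
  rw [hx, Complex.norm_natCast]
  exact_mod_cast (f x).2.le

/-- A labelling by `{0, …, k - 1}` as a bounded function. -/
noncomputable def linfLabel (μ : Measure X) (f : X → Fin k) (hf : Measurable f) : Linf μ :=
  ⟨AEEqFun.mk (fun x => ((f x : ℕ) : ℂ)) (aestronglyMeasurable_label hf), k, ae_norm_label hf⟩

theorem coeFn_linfLabel {f : X → Fin k} (hf : Measurable f) :
    (linfLabel μ f hf).1 =ᵐ[μ] fun x => ((f x : ℕ) : ℂ) := AEEqFun.coeFn_mk _ _

theorem aeval_linfLabel_labelPoly {f : X → Fin k} (hf : Measurable f) :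
    Polynomial.aeval (linfLabel μ f hf).1 (labelPoly k) = 0 := by
  refine AEEqFun.ext ?_
  filter_upwards [coeFn_aeval (labelPoly k) (linfLabel μ f hf).1, coeFn_linfLabel hf (μ := μ),
    AEEqFun.coeFn_zero (μ := μ) (β := ℂ)] with x h1 h2 h3
  rw [h1, h2, h3, eval_labelPoly_natCast, Pi.zero_apply]

/-- Interpolation makes each label class a polynomial in the label function, so algebra
homomorphisms can track it. -/
theorem aeval_linfLabel_indicatorPoly {f : X → Fin k} (hf : Measurable f) (j : Fin k) :
    Polynomial.aeval (linfLabel μ f hf).1 (indicatorPoly j) =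
      (linfIndicator μ (f ⁻¹' {j}) (hf (measurableSet_singleton j)).nullMeasurableSet).1 := by
  refine AEEqFun.ext ?_
  filter_upwards [coeFn_aeval (indicatorPoly j) (linfLabel μ f hf).1,
    coeFn_linfLabel hf (μ := μ),
    coeFn_linfIndicator (μ := μ) (hf (measurableSet_singleton j)).nullMeasurableSet]
    with x h1 h2 h3
  rw [h1, h2, h3, eval_indicatorPoly]
  by_cases hx : f x = j <;> simp [hx]

end Labelling

/-! ### Passing labellings to and from the ultraproduct -/

section Lifting

variable {k : ℕ} {X : ℕ → Type v} [∀ i, MeasurableSpace (X i)]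
  {Ω : Type w} [MeasurableSpace Ω]
  {U : Ultrafilter ℕ} {μ : ∀ i, Measure (X i)} {ν : Measure Ω}

/-- A sequence of labellings as a bounded sequence of functions. -/
noncomputable def seqLabel (μ : ∀ i, Measure (X i)) (f : ∀ i, X i → Fin k)
    (hf : ∀ i, Measurable (f i)) : BddSeq μ :=
  ⟨fun i => (linfLabel (μ i) (f i) (hf i)).1, k, fun i => ae_norm_label (hf i)⟩

variable (Φ : UltraAlgebra U μ ≃ₐ[ℂ] Linf ν)

theorem map_ulim_aeval (h : BddSeq μ) (p : Polynomial ℂ) :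
    Φ (ulim U μ (Polynomial.aeval h p)) = Polynomial.aeval (Φ (ulim U μ h)) p := by
  have h1 := Polynomial.aeval_algHom_apply
    (Φ.toAlgHom.comp (Ideal.Quotient.mkₐ ℂ (nullIdeal U μ))) h p
  exact h1.symm

variable {Φ}

theorem matched_label {f : ∀ i, X i → Fin k} {hf : ∀ i, Measurable (f i)} {g : Ω → Fin k}
    {hg : Measurable g} (h : Φ (ulim U μ (seqLabel μ f hf)) = linfLabel ν g hg) (j : Fin k) :
    Matched Φ (fun i => f i ⁻¹' {j}) (g ⁻¹' {j}) := by
  refine ⟨fun i => (hf i (measurableSet_singleton j)).nullMeasurableSet,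
    (hg (measurableSet_singleton j)).nullMeasurableSet, ?_⟩
  have h1 : seqIndicator μ (fun i => f i ⁻¹' {j})
      (fun i => (hf i (measurableSet_singleton j)).nullMeasurableSet) =
      Polynomial.aeval (seqLabel μ f hf) (indicatorPoly j) :=
    Subtype.ext (funext fun i => by
      rw [coe_aeval_bddSeq]
      exact (aeval_linfLabel_indicatorPoly (hf i) j).symm)
  rw [h1, map_ulim_aeval, h]
  exact Subtype.ext ((coe_aeval_linf _ _).trans (aeval_linfLabel_indicatorPoly hg j))

/-- Every sequence of labellings has an ultralimit. -/
theorem exists_limit_label (hk : 0 < k) (f : ∀ i, X i → Fin k) (hf : ∀ i, Measurable (f i)) :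
    ∃ (g : Ω → Fin k) (hg : Measurable g), Φ (ulim U μ (seqLabel μ f hf)) = linfLabel ν g hg := by
  obtain ⟨F, hF, hbound⟩ := exists_measurable_round hk
  set H := Φ (ulim U μ (seqLabel μ f hf)) with hH
  have h1 : Polynomial.aeval (seqLabel μ f hf) (labelPoly k) = 0 :=
    Subtype.ext (funext fun i => by
      rw [coe_aeval_bddSeq]
      exact aeval_linfLabel_labelPoly (hf i))
  have h2 : Polynomial.aeval H.1 (labelPoly k) = 0 := by
    rw [← coe_aeval_linf, hH, ← map_ulim_aeval, h1, ulim, map_zero, map_zero]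
    rfl
  -- Rounding only chooses a representative with values in `Fin k` everywhere: where `labelPoly k`
  -- vanishes at `H.1 x`, the rounding bound forces equality.
  have hg : Measurable fun x => F (H.1 x) := hF.comp H.1.measurable
  refine ⟨_, hg, Subtype.ext (AEEqFun.ext ?_)⟩
  have h3 := coeFn_aeval (labelPoly k) H.1
  rw [h2] at h3
  filter_upwards [h3, coeFn_linfLabel hg (μ := ν), AEEqFun.coeFn_zero (μ := ν) (β := ℂ)]
    with x h4 h5 h6
  rw [h5]
  have h7 := hbound (H.1 x)
  rw [← h4, h6, Pi.zero_apply, norm_zero, mul_zero] at h7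
  exact sub_eq_zero.1 (norm_le_zero_iff.1 h7)

/-- Every labelling of an ultraproduct is an ultralimit of labellings. -/
theorem exists_lift_label (hk : 0 < k) (g : Ω → Fin k) (hg : Measurable g) :
    ∃ (f : ∀ i, X i → Fin k) (hf : ∀ i, Measurable (f i)),
      Φ (ulim U μ (seqLabel μ f hf)) = linfLabel ν g hg := by
  obtain ⟨F, hF, hbound⟩ := exists_measurable_round hk
  obtain ⟨h, hh⟩ := Ideal.Quotient.mk_surjective (Φ.symm (linfLabel ν g hg))
  have hh' : Φ (ulim U μ h) = linfLabel ν g hg := by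
    rw [ulim, hh, AlgEquiv.apply_symm_apply]
  have hf : ∀ i, Measurable fun x => F (h.1 i x) := fun i => hF.comp (h.1 i).measurable
  refine ⟨_, hf, ?_⟩
  rw [← hh']
  congr 1
  refine (Ideal.Quotient.eq).2 ?_
  -- The representatives `h i` need not be labellings, but they satisfy the polynomial equation up
  -- to a null sequence.
  have h1 : ulim U μ (Polynomial.aeval h (labelPoly k)) = 0 := by
    apply Φ.injective
    rw [map_ulim_aeval, hh', map_zero]
    exact Subtype.ext ((coe_aeval_linf _ _).trans (aeval_linfLabel_labelPoly hg))
  have h2 : Tendsto (fun i => eLpNorm ((Polynomial.aeval h (labelPoly k)).1 i) 2 (μ i)) U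
      (𝓝 0) := Ideal.Quotient.eq_zero_iff_mem.1 h1
  have h3 := ENNReal.Tendsto.const_mul (a := ((2 ^ k : NNReal) : ENNReal)) h2
    (Or.inr ENNReal.coe_ne_top)
  rw [mul_zero] at h3
  refine tendsto_of_tendsto_of_tendsto_of_le_of_le tendsto_const_nhds h3 (fun _ => zero_le)
    fun i => ?_
  -- The rounding error is bounded pointwise by `2 ^ k` times the value of `labelPoly k`, hence is a
  -- null sequence too.
  refine eLpNorm_le_nnreal_smul_eLpNorm_of_ae_le_mul ?_ 2
  change ∀ᵐ x ∂μ i, ‖((linfLabel (μ i) _ (hf i)).1 - h.1 i : X i →ₘ[μ i] ℂ) x‖₊ ≤ _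
  have h4 := coeFn_aeval (labelPoly k) (h.1 i)
  rw [← coe_aeval_bddSeq] at h4
  filter_upwards [h4, coeFn_linfLabel (hf i) (μ := μ i),
    AEEqFun.coeFn_sub (linfLabel (μ i) _ (hf i)).1 (h.1 i)] with x h5 h6 h7
  rw [h5, h7, Pi.sub_apply, h6]
  exact (norm_sub_rev _ _).trans_le (hbound (h.1 i x))

end Lifting

/-! ## Convergence of local statistics -/

section Convergence

variable {n u r k : ℕ} [NeZero u] {X : ℕ → Type v} [∀ i, MeasurableSpace (X i)]
  {Ω : Type w} [MeasurableSpace Ω]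
  {U : Ultrafilter ℕ} {μ : ∀ i, Measure (X i)} {ν : Measure Ω}
  [∀ i, MulAction (FreePower n u) (X i)] [∀ i, MeasurableConstSMul (FreePower n u) (X i)]
  [MulAction (FreePower n u) Ω] [MeasurableConstSMul (FreePower n u) Ω]
  [∀ i, SMulInvariantMeasure (FreePower n u) (X i) (μ i)]
  [∀ i, FixNullMeasurable (FreePower n u) (X i) (μ i)]
  [SMulInvariantMeasure (FreePower n u) Ω ν] [FixNullMeasurable (FreePower n u) Ω ν]
  {Φ : UltraAlgebra U μ ≃ₐ[ℂ] Linf ν}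

omit [NeZero u] in
-- Both the union and the intersection are finite, because `testSet n u r` and `Fin k × Prop` are;
-- matching passes through finite operations.
theorem setOf_pattern_mem {Y : Type*} [MulAction (FreePower n u) Y] (f : Y → Fin k)
    (S : Set (testSet n u r → Fin k × Prop)) :
    {x | pattern n u r f x ∈ S} = ⋃ p : S, ⋂ δ : testSet n u r,
      ((δ.1 • ·) ⁻¹' (f ⁻¹' {(p.1 δ).1})) ∩ {x | x ∈ MulAction.fixedBy Y δ.1 ↔ (p.1 δ).2} := by
  ext x
  simp only [Set.mem_ofPred_eq, Set.mem_iUnion, Set.mem_iInter, Set.mem_inter_iff,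
    Set.mem_preimage, Set.mem_singleton_iff]
  constructor
  · exact fun h => ⟨⟨_, h⟩, fun δ => ⟨rfl, Iff.rfl⟩⟩
  · rintro ⟨p, hp⟩
    have : pattern n u r f x = p.1 := funext fun δ => Prod.ext (hp δ).1 (propext (hp δ).2)
    rw [this]
    exact p.2

theorem Matched.pattern_mem (hΦ : IsModelIso n u U μ ν Φ) {f : ∀ i, X i → Fin k} {g : Ω → Fin k}
    (h : ∀ j, Matched Φ (fun i => f i ⁻¹' {j}) (g ⁻¹' {j}))
    (S : Set (testSet n u r → Fin k × Prop)) :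
    Matched Φ (fun i => {x | pattern n u r (f i) x ∈ S}) {x | pattern n u r g x ∈ S} := by
  simp only [setOf_pattern_mem]
  refine iUnion fun p => iInter fun δ => ((h _).preimage_smul hΦ δ.1).inter ?_
  by_cases hp : (p.1 δ).2
  · simp only [hp, iff_true]
    exact fixedBy hΦ δ.1
  · simp only [hp, iff_false]
    exact (fixedBy hΦ δ.1).compl

/-- Each coordinate is the measure of a set cut out by the same patterns in every action, so the
coordinates converge separately. -/
theorem tendsto_localStatistics (hΦ : IsModelIso n u U μ ν Φ) {f : ∀ i, X i → Fin k}
    {g : Ω → Fin k} (h : ∀ j, Matched Φ (fun i => f i ⁻¹' {j}) (g ⁻¹' {j})) :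
    Tendsto (fun i => localStatistics n u r k (μ i) (f i)) U
      (𝓝 (localStatistics n u r k ν g)) := by
  refine ((PiLp.continuous_toLp 1 _).tendsto _).comp (tendsto_pi_nhds.2 fun c => ?_)
  simp only [hasType_iff_pattern_mem]
  exact (Matched.pattern_mem hΦ h _).tendsto_measure hΦ

/-- There are finitely many types, so the statistics lie in a finite-dimensional unit cube. -/
theorem totallyBounded_exactLocalStats {Y : Type*} [MulAction (FreePower n u) Y]
    [MeasurableSpace Y] (κ : Measure Y) [IsProbabilityMeasure κ] :
    TotallyBounded (exactLocalStats n u r k κ) := by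
  have hK : IsCompact (WithLp.toLp 1 '' Set.Icc (0 : ActionType n u r k → ℝ) 1) :=
    isCompact_Icc.image (PiLp.continuous_toLp 1 _)
  refine hK.totallyBounded.subset ?_
  rintro _ ⟨f, -, rfl⟩
  exact ⟨_, ⟨fun _ => measureReal_nonneg, fun _ => measureReal_le_one⟩, rfl⟩

end Convergence

/-- A criterion for the convergence of the closures of a sequence of sets along an ultrafilter in
the Hausdorff metric. -/
theorem tendsto_closeds_closure {α : Type*} [EMetricSpace α] {U : Ultrafilter ℕ} {S : ℕ → Set α}
    {T : Set α} (hT : TotallyBounded T)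
    (hlift : ∀ p ∈ T, ∃ q : ℕ → α, (∀ i, q i ∈ S i) ∧ Tendsto q U (𝓝 p))
    (hlim : ∀ q : ℕ → α, (∀ᶠ i in U, q i ∈ S i) → ∃ p ∈ T, Tendsto q U (𝓝 p)) :
    Tendsto (fun i => TopologicalSpace.Closeds.closure (S i)) U
      (𝓝 (TopologicalSpace.Closeds.closure T)) := by
  rw [EMetric.tendsto_nhds]
  intro ε hε
  obtain ⟨δ, hδ, hδε⟩ := exists_between hε
  -- Only a finite net of `T` has to be lifted, and finitely many conditions hold together on a
  -- `U`-large set.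
  have h1 : ∀ᶠ i in U, ∀ p ∈ T, ∃ q ∈ S i, edist p q ≤ δ := by
    have hδ2 : 0 < δ / 2 := ENNReal.half_pos hδ.ne'
    obtain ⟨t, htT, ht, hcover⟩ := EMetric.totallyBounded_iff'.1 hT (δ / 2) hδ2
    have h2 : ∀ p ∈ t, ∀ᶠ i in U, ∃ q ∈ S i, edist p q < δ / 2 := by
      intro p hp
      obtain ⟨q, hq, hqp⟩ := hlift p (htT hp)
      filter_upwards [EMetric.tendsto_nhds.1 hqp _ hδ2] with i hi
      exact ⟨q i, hq i, by rwa [edist_comm]⟩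
    filter_upwards [(ht.eventually_all).2 h2] with i hi p hp
    obtain ⟨p', hp', hpp'⟩ := Set.mem_iUnion₂.1 (hcover hp)
    obtain ⟨q, hq, hq'⟩ := hi p' hp'
    refine ⟨q, hq, (edist_triangle p p' q).trans ?_⟩
    rw [← ENNReal.add_halves δ]
    exact add_le_add (le_of_lt hpp') hq'.le
  have h2 : ∀ᶠ i in U, ∀ q ∈ S i, ∃ p ∈ T, edist q p ≤ δ := by
    by_contra hcon
    -- Failure to hold `U`-often means that far-away points exist for `U`-almost all `i`; a sequence
    -- of them would converge into `T`. The point `q₀` fills the remaining indices.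
    rw [← Ultrafilter.eventually_not] at hcon
    push Not at hcon
    obtain ⟨i₀, q₀, -⟩ := hcon.exists
    have : ∀ i, ∃ q, (∃ q ∈ S i, ∀ p ∈ T, δ < edist q p) →
        q ∈ S i ∧ ∀ p ∈ T, δ < edist q p := fun i => by
      by_cases h : ∃ q ∈ S i, ∀ p ∈ T, δ < edist q p
      · exact ⟨h.choose, fun _ => h.choose_spec⟩
      · exact ⟨q₀, fun h' => absurd h' h⟩
    choose q hq using this
    obtain ⟨p, hp, hqp⟩ := hlim q (hcon.mono fun i hi => (hq i hi).1)
    obtain ⟨i, hi, hi'⟩ := ((EMetric.tendsto_nhds.1 hqp δ hδ).and hcon).exists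
    exact lt_asymm hi ((hq i hi').2 p hp)
  filter_upwards [h1, h2] with i hi1 hi2
  refine lt_of_le_of_lt ?_ hδε
  rw [TopologicalSpace.Closeds.edist_eq]
  exact Metric.hausdorffEDist_closure.trans_le (Metric.hausdorffEDist_le_of_mem_edist hi2 hi1)

end LocalGlobal

theorem mainTheorem2 (n u : ℕ) [NeZero u] (U : Ultrafilter ℕ)
    (X : ℕ → Type v) [∀ i, MeasurableSpace (X i)] [∀ i, StandardBorelSpace (X i)]
    (μ : ∀ i, Measure (X i)) [∀ i, IsProbabilityMeasure (μ i)]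
    [∀ i, MulAction (LocalGlobal.FreePower n u) (X i)]
    [∀ i, MeasurableConstSMul (LocalGlobal.FreePower n u) (X i)]
    [∀ i, SMulInvariantMeasure (LocalGlobal.FreePower n u) (X i) (μ i)]
    (Ω : Type w) [MeasurableSpace Ω] (ν : Measure Ω) [IsProbabilityMeasure ν]
    [MulAction (LocalGlobal.FreePower n u) Ω]
    [MeasurableConstSMul (LocalGlobal.FreePower n u) Ω]
    [SMulInvariantMeasure (LocalGlobal.FreePower n u) Ω ν]
    [LocalGlobal.FixNullMeasurable (LocalGlobal.FreePower n u) Ω ν]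
    (hΩ : LocalGlobal.IsUltraproduct n u U μ ν) (r k : ℕ) :
    Tendsto (fun i => LocalGlobal.localStats n u r k (μ i)) U
      (𝓝 (LocalGlobal.localStats n u r k ν)) := by
  obtain ⟨Φ, hΦ⟩ := hΩ
  refine LocalGlobal.tendsto_closeds_closure (LocalGlobal.totallyBounded_exactLocalStats ν) ?_ ?_
  · rintro _ ⟨g, hg, rfl⟩
    -- The label of a point shows that `0 < k`; for `k = 0` there are no labellings to lift.
    obtain ⟨x⟩ := nonempty_of_isProbabilityMeasure ν
    obtain ⟨f, hf, hfg⟩ := LocalGlobal.exists_lift_label (Φ := Φ) (g x).pos g hg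
    exact ⟨_, fun i => ⟨f i, hf i, rfl⟩, LocalGlobal.tendsto_localStatistics hΦ (LocalGlobal.matched_label hfg)⟩
  · intro q hq
    -- One index with a labelling supplies both `0 < k` and the constant label used at the indices
    -- where `q i` is not a statistic.
    obtain ⟨i₀, f₀, -, -⟩ := hq.exists
    obtain ⟨x₀⟩ := nonempty_of_isProbabilityMeasure (μ i₀)
    have hex : ∀ i, ∃ f : X i → Fin k, Measurable f ∧
        (q i ∈ LocalGlobal.exactLocalStats n u r k (μ i) → q i = LocalGlobal.localStatistics n u r k (μ i) f) := by
      intro i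
      by_cases h : q i ∈ LocalGlobal.exactLocalStats n u r k (μ i)
      · obtain ⟨f, hf, hqf⟩ := h
        exact ⟨f, hf, fun _ => hqf⟩
      · exact ⟨fun _ => f₀ x₀, measurable_const, fun h' => absurd h' h⟩
    choose f hf hqf using hex
    obtain ⟨g, hg, hfg⟩ := LocalGlobal.exists_limit_label (Φ := Φ) (f₀ x₀).pos f hf
    refine ⟨_, ⟨g, hg, rfl⟩, (LocalGlobal.tendsto_localStatistics hΦ (LocalGlobal.matched_label hfg)).congr' ?_⟩
    exact hq.mono fun i hi => (hqf i hi).symm
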